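/- **Setting.** Let $m,J_1,J_2,J_3>0$, $g\in\mathbb R$, and let $\Delta\ge 0$ be the uncertainty level. A motion $(x,v,R,\Omega)$ of the quadrotor, $R\in SO(3)$, $\Omega=(\Omega_1,\Omega_2,\Omega_3)$ in the body frame, satisfies $$\dot x=v,\quad m\dot v=-mge_3+fRe_3,\quad \dot R=R\hat\Omega,$$ $$\dot{\tilde\Omega}=f_J(\Omega)+U+d,\qquad \dot\Omega_3=\tfrac{J_1-J_2}{J_3}\Omega_1\Omega_2+\tau,$$ where $\hat\Omega y=\Omega\times y$, $\tilde\Omega=(\Omega_1,\Omega_2)$, $f_J(\Omega)=\big(\tfrac{J_2-J_3}{J_1}\Omega_2\Omega_3,\tfrac{J_3-J_1}{J_2}\Omega_1\Omega_3\big)$, $\tau$ is an arbitrary signal (the moment about the thrust axis is not controlled), and the uncertainty $d$ is any signal with $\|d\|\le(\|\tilde\Omega\|+\|\tilde\Omega\|^2)\Delta$. Put $q=Re_3$, $r_1=Re_1$, $r_2=Re_2$, and for $y\in\mathbb R^3$ put $h_R(y)=(-\langle r_2,y\rangle,\langle r_1,y\rangle)$, so that $\dot q=\Omega_2r_1-\Omega_1r_2$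 and $h_R(\dot q)=\tilde\Omega$. *Thrust law.* Let $x_d$ be a smooth reference trajectory, bounded together with all its derivatives on $[0,\infty)$; $e_x=x-x_d$, $e_v=v-\dot x_d$, $f_d=m\ddot x_d+mge_3$. A smooth $\sigma:\mathbb R\to\mathbb R$ is a saturation with limits $(a,b)$, $0<a\le b$, if $s\sigma(s)>0$ for $s\ne0$, $\sigma(s)=s$ for $|s|\le a$, and $|\sigma|\le b$. Let $\sigma_1,\sigma_2$ be saturations with limits $(a_1,b_1)$, $(a_2,b_2)$, $b_1<a_2/2$, let $k_1,k_2>0$, and let $$\hat f=\bar\sigma(e_x,e_v)+f_d,\qquad \bar\sigma(e_x,e_v)_i=-\sigma_2\Big(\tfrac{k_1}{k_2}e_{v,i}+\sigma_1(k_2m\,e_{v,i}+k_1e_{x,i})\Big),\quad i=1,2,3.$$ Assume that $\|\hat f\|$ is bounded away from zero, uniformly in $t\ge0$ and $(e_x,e_v)$ (for example because $b_2<\inf_t\|f_d(t)\|_\infty$). Put $q_d=\hat f/\|\hat f\|$ and $f=\langle\hat f,Re_3\rangle$. *Reduced attitude law.* Let $\Psi=2-\tfrac2{\sqrt2}\sqrt{1+q_d^Tq}$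 and $e_q=\dfrac{q\times(q\times q_d)}{\sqrt2\sqrt{1+q_d^Tq}}$. With gains $k_q,k_\Omega,\alpha>0$ and a tolerance $tol>0$, put $\Omega_d=h_R\big((q_d\times\dot q_d)\times q-k_qe_q\big)$, $e_\Omega=\tilde\Omega-\Omega_d$, and $$U=-\alpha\,h_R(e_q)-k_\Omega e_\Omega-f_J(\Omega)+\dot\Omega_d-(\|\tilde\Omega\|+\|\tilde\Omega\|^2)\Delta\,U_\Delta,$$ where $U_\Delta=e_\Omega/\|e_\Omega\|$ if $\|e_\Omega\|>tol$ and $U_\Delta=e_\Omega/tol$ otherwise. *Gain conditions.* Let $0\le\theta_0<\pi/2$, $s=\sin\theta_0$, $k_x=k_1$, $k_v=k_1/k_2+mk_2$, and let $c>0$ satisfy $$c<\min\Big\{k_xk_v(1-s)^2\Big(k_x(1-s)+\tfrac{k_v^2(1+s)^2}{4m}\Big)^{-1},\;k_v(1-s),\;\sqrt{k_x/m}\Big\}.$$ With $$W_1=\begin{bmatrix}\frac{ck_x}{m}(1-s)&-\frac{ck_v}{2m}(1+s)\\-\frac{ck_v}{2m}(1+s)&k_v(1-s)-c\end{bmatrix},\qquad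 W_2=2\begin{bmatrix}\frac cm\|f_d\|&0\\a_1+\|f_d\|&0\end{bmatrix}$$ (spectral norm), assume $\min(\alpha k_q,k_\Omega)>4\|W_2\|^2/\lambda_{\min}(W_1)$ for all $t\ge0$. **Theorem 2.** The set $S$ of the initial states $(x,v,R,\Omega)$ in $\mathbb R^3\times\mathbb R^3\times SO(3)\times\mathbb R^3$ with $\Psi(0)<2$ is open and dense. Write $E(t)=\|e_x\|+\|e_v\|+\|e_q\|+\|e_\Omega\|$. There is a rate $\lambda>0$ such that for every $r$ there is a constant $C$ such that for every $\varepsilon>0$ there is $tol_0>0$ with the following property. If $0<tol\le tol_0$, then every motion of the closed loop on $[0,\infty)$, or on some $[0,T)$, that starts in $S$ with $E(0)\le r$ and $$\|e_\Omega(0)\|^2<2\alpha(2-\Psi(0))$$ satisfies $\Psi(t)<2$ and $E(t)\le Ce^{-\lambda t}+\varepsilon$ at all times $t$ of the motion. Thus $e_x,e_v,e_q,e_\Omega$ converge exponentially to an arbitrarily small neighbourhood of the origin. If moreover $\sigma_1$ and $\sigma_2$ are nondecreasing, $tol_0$ can be chosen independently of $r$, so that one controller serves all these initial conditions. -/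

import Mathlib

open scoped ContDiff RealInnerProductSpace

noncomputable section

namespace Quadrotor

/-- Physical space, with the Euclidean norm. -/
abbrev E3 := EuclideanSpace ℝ (Fin 3)

/-- The space of the two horizontal body components, with the Euclidean norm. -/
abbrev E2 := EuclideanSpace ℝ (Fin 2)

/-- The rotation group. -/
abbrev SO3 := Matrix.specialOrthogonalGroup (Fin 3) ℝ

/-- The vertical unit vector `e₃`. -/
def e3 : E3 := !₂[0, 0, 1]

/-- The cross product on Euclidean space. -/
def cross (a b : E3) : E3 := WithLp.toLp 2 (crossProduct a.ofLp b.ofLp)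

/-- The hat map: `hat w * y = w × y`. -/
def hat (w : E3) : Matrix (Fin 3) (Fin 3) ℝ :=
  !![0, -w 2, w 1; w 2, 0, -w 0; -w 1, w 0, 0]

/-- The `i`-th body axis `R e_i` (`i = 0, 1` are the horizontal axes `r₁, r₂`, `i = 2` is the
thrust axis `q = R e₃`). -/
def bodyAxis (R : SO3) (i : Fin 3) : E3 := WithLp.toLp 2 (fun k => R.1 k i)

/-! ### Reduced attitude errors on the sphere -/

/-- The attitude error function `Ψ(q, q_d) = 2 - (2/√2) √(1 + q_dᵀ q)`. -/
def Psi (q qd : E3) : ℝ := 2 - 2 / √2 * √(1 + ⟪qd, q⟫)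

/-- The attitude error vector `e_q = d₁Ψ(q, q_d) = q × (q × q_d) / (√2 √(1 + q_dᵀ q))`. -/
def attErr (q qd : E3) : E3 := (1 / (√2 * √(1 + ⟪qd, q⟫))) • cross q (cross q qd)

/-- The transport map `T(q, q_d) w = (q_d × w) × q`. -/
def transport (q qd w : E3) : E3 := cross (cross qd w) q

/-- The pair `w = (w₁, w₂)` with `R (w₁, w₂, 0)ᵀ × e₃ = y`, for `y` tangent to the sphere at
`R e₃`; explicitly `w₁ = -⟨r₂, y⟩`, `w₂ = ⟨r₁, y⟩`, since `R (Ω × e₃) = Ω₂ r₁ - Ω₁ r₂`. -/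
def horizontal (R : SO3) (y : E3) : E2 := !₂[-⟪bodyAxis R 1, y⟫, ⟪bodyAxis R 0, y⟫]

/-! ### Saturation functions -/

/-- Smooth linear saturation function with limits `(a, b)`. -/
structure IsSaturation (a b : ℝ) (σ : ℝ → ℝ) : Prop where
  a_pos : 0 < a
  a_le_b : a ≤ b
  smooth : ContDiff ℝ ∞ σ
  sign : ∀ s, s ≠ 0 → 0 < s * σ s
  linear : ∀ s, |s| ≤ a → σ s = s
  bounded : ∀ s, |σ s| ≤ b

/-! ### The plant, the reference and the control law -/

/-- The data of the problem: mass `m`, gravity `g`, principal moments of inertia `J₁, J₂, J₃`,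
the gains `k₁, k₂, k_q, k_Ω, α`, the uncertainty level `Δ`, the two saturation functions and the
reference position trajectory. -/
structure Params where
  (m g J₁ J₂ J₃ : ℝ)
  (k₁ k₂ kq kΩ α Δ : ℝ)
  (σ₁ σ₂ : ℝ → ℝ)
  xd : ℝ → E3

/-- A motion: position, velocity, attitude, and angular velocity in the body frame. -/
structure Motion where
  x : ℝ → E3
  v : ℝ → E3
  R : ℝ → SO3
  Ω : ℝ → E3

namespace Params

variable (p : Params)

/-- The feedforward thrust `f_d = m ẍ_d + m g e₃`. -/
def fd (t : ℝ) : E3 := p.m • iteratedDeriv 2 p.xd t + (p.m * p.g) • e3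

/-- The nested saturation feedback. -/
def sigmaBar (ex ev : E3) : E3 :=
  WithLp.toLp 2 (fun i =>
    -p.σ₂ (p.k₁ / p.k₂ * ev i + p.σ₁ (p.k₂ * p.m * ev i + p.k₁ * ex i)))

/-- The commanded thrust vector, as a function of time and of the position and velocity errors. -/
def thrust (t : ℝ) (ex ev : E3) : E3 := p.sigmaBar ex ev + p.fd t

/-- The commanded thrust is bounded away from zero as soon as `b₂ < inf ‖f_d‖_∞`. -/
theorem thrust_bounded_away (a₂ b₂ β : ℝ) (hσ : IsSaturation a₂ b₂ p.σ₂) (hb : b₂ < β)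
    (hβ : ∀ t, 0 ≤ t → ∃ i, β ≤ |p.fd t i|) :
    ∃ μ > 0, ∀ t, 0 ≤ t → ∀ ex ev : E3, μ ≤ ‖p.thrust t ex ev‖ := by
  refine ⟨β - b₂, by linarith, fun t ht ex ev => ?_⟩
  obtain ⟨i, hi⟩ := hβ t ht
  have h1 : ‖p.thrust t ex ev i‖ ≤ ‖p.thrust t ex ev‖ := PiLp.norm_apply_le _ i
  have h2 := hσ.bounded (p.k₁ / p.k₂ * ev i + p.σ₁ (p.k₂ * p.m * ev i + p.k₁ * ex i))
  have h3 : p.thrust t ex ev i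
      = p.fd t i - p.σ₂ (p.k₁ / p.k₂ * ev i + p.σ₁ (p.k₂ * p.m * ev i + p.k₁ * ex i)) := by
    simp [thrust, sigmaBar]; ring
  rw [h3, Real.norm_eq_abs] at h1
  have h4 := abs_sub_abs_le_abs_sub (p.fd t i)
    (p.σ₂ (p.k₁ / p.k₂ * ev i + p.σ₁ (p.k₂ * p.m * ev i + p.k₁ * ex i)))
  linarith

/-- The commanded thrust vector as a function of time, position and velocity. -/
def fhat (t : ℝ) (x v : E3) : E3 := p.thrust t (x - p.xd t) (v - deriv p.xd t)

/-- The commanded reduced attitude. -/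
def qd (t : ℝ) (x v : E3) : E3 := ‖p.fhat t x v‖⁻¹ • p.fhat t x v

/-- The net thrust `f = ⟨f̂, R e₃⟩`. -/
def netThrust (t : ℝ) (x v : E3) (R : SO3) : ℝ := ⟪p.fhat t x v, bodyAxis R 2⟫

/-- The gyroscopic term `f_J(Ω)` of the two horizontal axes. -/
def fJ (Ω : E3) : E2 :=
  !₂[(p.J₂ - p.J₃) / p.J₁ * Ω 1 * Ω 2, (p.J₃ - p.J₁) / p.J₂ * Ω 0 * Ω 2]

/-- The initial states `(x, v, R, Ω)` with attitude error `Ψ < 2` at time `0`. -/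
def goodStates : Set (E3 × E3 × SO3 × E3) :=
  {z | Psi (bodyAxis z.2.2.1 2) (p.qd 0 z.1 z.2.1) < 2}

end Params

/-- The horizontal part `(Ω₁, Ω₂)` of the angular velocity. -/
def horiz (Ω : E3) : E2 := !₂[Ω 0, Ω 1]

/-- The smoothed unit vector `U_Δ`. -/
def unitSat (tol : ℝ) (e : E2) : E2 := if tol < ‖e‖ then ‖e‖⁻¹ • e else tol⁻¹ • e

/-! ### Signals along a motion

Time derivatives are taken within the time interval `I` of the motion, hence they are one-sided at
the initial time. -/

namespace Motion

variable (X : Motion) (p : Params) (I : Set ℝ) (t : ℝ)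

/-- The position error. -/
def ex : E3 := X.x t - p.xd t

/-- The velocity error. -/
def ev : E3 := X.v t - deriv p.xd t

/-- The reduced attitude. -/
def q : E3 := bodyAxis (X.R t) 2

/-- The commanded reduced attitude. -/
def qd : E3 := p.qd t (X.x t) (X.v t)

/-- The value of the attitude error function. -/
def psi : ℝ := Psi (X.q t) (X.qd p t)

/-- The reduced attitude error vector. -/
def eq : E3 := attErr (X.q t) (X.qd p t)

/-- The commanded horizontal angular velocity: the solution of
`R ((Ω_d1, Ω_d2, 0) × e₃) = T(q, q_d) q̇_d - k_q e_q`. -/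
def Ωd : E2 :=
  horizontal (X.R t)
    (transport (X.q t) (X.qd p t) (derivWithin (X.qd p) I t) - p.kq • X.eq p t)

/-- The angular velocity error. -/
def eΩ : E2 := horiz (X.Ω t) - X.Ωd p I t

/-- The worst-case size of the uncertainty. -/
def uncertainty : ℝ := (‖horiz (X.Ω t)‖ + ‖horiz (X.Ω t)‖ ^ 2) * p.Δ

/-- The reduced attitude control law. -/
def U (tol : ℝ) : E2 :=
  -(p.α • horizontal (X.R t) (X.eq p t)) - p.kΩ • X.eΩ p I t - p.fJ (X.Ω t)
    + derivWithin (X.Ωd p I) I t - X.uncertainty p t • unitSat tol (X.eΩ p I t)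

/-- The total size of the tracking errors. -/
def totalError : ℝ := ‖X.ex p t‖ + ‖X.ev p t‖ + ‖X.eq p t‖ + ‖X.eΩ p I t‖

end Motion

/-- `X` is a motion of the closed loop on the time interval `I`, with uncertainty `d` in the two
horizontal angular accelerations, and with an arbitrary angular acceleration `τ` caused by the
uncontrolled moment about the thrust axis. -/
structure IsClosedLoop (p : Params) (tol : ℝ) (I : Set ℝ) (d : ℝ → E2) (τ : ℝ → ℝ)
    (X : Motion) : Prop where
  pos : ∀ t ∈ I, HasDerivWithinAt X.x (X.v t) I t
  vel : ∀ t ∈ I, HasDerivWithinAt X.v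
    (p.m⁻¹ • (-(p.m * p.g) • e3
      + p.netThrust t (X.x t) (X.v t) (X.R t) • bodyAxis (X.R t) 2)) I t
  att : ∀ t ∈ I, ∀ i j, HasDerivWithinAt (fun s => (X.R s).1 i j)
    (((X.R t).1 * hat (X.Ω t)) i j) I t
  ang : ∀ t ∈ I, HasDerivWithinAt (fun s => horiz (X.Ω s))
    (p.fJ (X.Ω t) + X.U p I t tol + d t) I t
  axial : ∀ t ∈ I, HasDerivWithinAt (fun s => X.Ω s 2)
    ((p.J₁ - p.J₂) / p.J₃ * X.Ω t 0 * X.Ω t 1 + τ t) I t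
  unc : ∀ t ∈ I, ‖d t‖ ≤ X.uncertainty p t

/-- The time interval `[0, T)`, where `T` may be `∞`. -/
def timeInterval (T : EReal) : Set ℝ := {t | 0 ≤ t ∧ (t : EReal) < T}

/-- Every closed-loop motion (on `[0, ∞)` or on some `[0, T)`) that starts with total error at
most `r`, in the set `Ψ < 2`, and with `‖e_Ω(0)‖² < 2 α (2 - Ψ(0))`, keeps `Ψ < 2` (so that
the control law stays well defined), and its total error is at most `C exp(-lam t) + ε`. -/
def ConvergesFrom (p : Params) (tol r C lam ε : ℝ) : Prop :=
  ∀ (T : EReal) (d : ℝ → E2) (τ : ℝ → ℝ) (X : Motion), 0 < T →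
    IsClosedLoop p tol (timeInterval T) d τ X →
    X.totalError p (timeInterval T) 0 ≤ r →
    (X.x 0, X.v 0, X.R 0, X.Ω 0) ∈ p.goodStates →
    ‖X.eΩ p (timeInterval T) 0‖ ^ 2 < 2 * p.α * (2 - X.psi p 0) →
    ∀ t ∈ timeInterval T,
      X.psi p t < 2 ∧ X.totalError p (timeInterval T) t ≤ C * Real.exp (-lam * t) + ε

/-! ### The matrices of the gain conditions -/

/-- The matrix `W₁`; here `s = sin θ₀`. -/
def W₁ (m kx kv c s : ℝ) : Matrix (Fin 2) (Fin 2) ℝ :=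
  !![c * kx / m * (1 - s), -(c * kv / (2 * m) * (1 + s));
     -(c * kv / (2 * m) * (1 + s)), kv * (1 - s) - c]

/-- The matrix `W₂`; here `F = ‖f_d‖`. -/
def W₂ (m c a₁ F : ℝ) : Matrix (Fin 2) (Fin 2) ℝ :=
  (2 : ℝ) • !![c / m * F, 0; a₁ + F, 0]

/-- The smallest eigenvalue of a real symmetric matrix. -/
def minEigenvalue (A : Matrix (Fin 2) (Fin 2) ℝ) : ℝ := sInf (spectrum ℝ A)

/-- The spectral norm of a matrix. -/
def specNorm (A : Matrix (Fin 2) (Fin 2) ℝ) : ℝ := ‖Matrix.toEuclideanCLM (𝕜 := ℝ) A‖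

end Quadrotor

end

/-!
The cascade structure carries the proof: the attitude errors can be estimated without any knowledge
of the position errors, and then act on the position errors as a decaying disturbance.

**Attitude.** Along a motion with `Ψ < 2` one has `Ψ' = ⟨h_R(e_q), e_Ω⟩ - k_q ‖e_q‖²`
(`IsClosedLoop.hasDerivWithinAt_psi`) and `Ψ / 2 ≤ ‖e_q‖² ≤ Ψ`. Outside the ball `‖e_Ω‖ < tol` the
robust term dominates the uncertainty, so `α Ψ + ‖e_Ω‖² / 2` decreases exponentially. Inside the
ball the uncertainty cannot be controlled (its bound grows with `Ω_d`, which has no a priori bound),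
but there `Ψ` alone decreases up to a term `tol ‖e_q‖`. Hence
`max (α Ψ) (α Ψ + (‖e_Ω‖² - tol²) / 2)` satisfies a linear differential inequality with an
inhomogeneity `α tol` (`IsClosedLoop.lyapunov_le`). Its initial value is less than `2 α` by the
assumption on `e_Ω(0)`, and it stays so; as it bounds `α Ψ`, the value `Ψ = 2` is never reached
(`IsClosedLoop.attitude_bounds`). All constants are independent of the initial state.

The control law contains time derivatives of `q_d` and `Ω_d`. They exist along a motion, because
`q_d` is a smooth function of `(t, x, v)`, and the derivative of `(t, x, v)` is a differentiable
function of time by the equations of motion.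

**Position.** As `f q - f̂ = ‖f̂‖ (⟨q_d, q⟩ q - q_d)` has norm at most `2 ‖f̂‖ ‖e_q‖`, and `f̂` is
bounded, every component of the position error is a double integrator with nested
saturations and an input that decays exponentially up to a constant of order `√tol`.
`nested_saturation_bound` treats it in the manner of Teel: the velocity error becomes so
small that `σ₂` acts linearly, then `u = k₂ m e_v + k₁ e_x` satisfies
`u' = -k₂ σ₁(u) + k₂ w` and enters the linear range of `σ₁`, and there the system is triangular in
`(u, e_v)`, with rates `k₂` and `k₁ / (k₂ m)`. The saturations have to beat the persistent part of
the input on the range of arguments that is visited. A general saturation may tend to zero at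
infinity, so that its lower bound there depends on the initial state; a nondecreasing one has a
uniform lower bound, which makes the tolerance independent of `r`.
-/

namespace Quadrotor

open Set Filter Topology

/-! ### Comparison lemmas -/

/-- A scalar signal that decreases at a definite rate, up to an exponentially decaying
perturbation, as long as it lies between `θ` and a suitable bound, stays below that bound, and is
below `θ` after a time that does not depend on the signal. -/
theorem exists_reach_time (θ Z₀ W lam ς : ℝ) (hθ : θ ≤ Z₀) (hW : 0 ≤ W) (hlam : 0 < lam)
    (hς : 0 < ς) :
    ∃ T₀ : ℝ, 0 ≤ T₀ ∧ ∀ (a b : ℝ) (f f' : ℝ → ℝ), 0 ≤ a → ContinuousOn f (Icc a b) →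
      (∀ t ∈ Ico a b, HasDerivWithinAt f (f' t) (Ici t) t) → f a ≤ Z₀ →
      (∀ t ∈ Ico a b, θ ≤ f t → f t ≤ Z₀ + W / lam → f' t ≤ -ς + W * Real.exp (-lam * t)) →
      ∀ t ∈ Icc a b, f t ≤ Z₀ + W / lam ∧ (a + T₀ ≤ t → f t ≤ θ) := by
  have hWl : 0 ≤ W / lam := by positivity
  refine ⟨2 * W / (lam * ς) + 4 * (Z₀ + W / lam - θ) / ς, ?_, ?_⟩
  · have : 0 ≤ Z₀ + W / lam - θ := by linarith
    positivity
  intro a b f f' ha hf hf' hfa hdec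
  have hup : ∀ t ∈ Icc a b, f t ≤ Z₀ + W / lam := by
    intro t ht
    have key := image_le_of_deriv_right_lt_deriv_boundary hf hf'
      (B := fun t => Z₀ + W / lam * (1 - Real.exp (-lam * t)))
      (B' := fun t => W * Real.exp (-lam * t))
      (by
        have : Real.exp (-lam * a) ≤ 1 := Real.exp_le_one_iff.2 (by nlinarith)
        have := mul_nonneg hWl (sub_nonneg.2 this)
        linarith)
      (by
        intro x
        have h1 : HasDerivAt (fun t => Real.exp (-lam * t)) (Real.exp (-lam * x) * (-lam * 1)) x :=
          ((hasDerivAt_id x).const_mul (-lam)).exp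
        have h2 := ((h1.const_sub 1).const_mul (W / lam)).const_add Z₀
        exact h2.congr_deriv (by field_simp))
      (by
        intro x hx hxe
        have hE := Real.exp_pos (-lam * x)
        have hE1 : Real.exp (-lam * x) ≤ 1 :=
          Real.exp_le_one_iff.2 (by nlinarith [hx.1])
        have h1 := hdec x hx
          (by rw [hxe]; have := mul_nonneg hWl (sub_nonneg.2 hE1); linarith)
          (by rw [hxe]; have := mul_nonneg hWl hE.le; linarith)
        linarith) ht
    have := mul_nonneg hWl (Real.exp_pos (-lam * t)).le
    linarith
  intro t ht
  refine ⟨hup t ht, fun hT => ?_⟩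
  -- After time `a'` the perturbation is at most `ς / 2`.
  set a' := a + 2 * W / (lam * ς) with ha'
  have hWς : 0 ≤ 2 * W / (lam * ς) := by positivity
  have hgap : 0 ≤ 4 * (Z₀ + W / lam - θ) / ς := by
    have : 0 ≤ Z₀ + W / lam - θ := by linarith
    positivity
  have hpert : ∀ s, a' ≤ s → W * Real.exp (-lam * s) ≤ ς / 2 := by
    intro s hs
    have h1 : lam * (2 * W / (lam * ς)) ≤ Real.exp (lam * s) := by
      have h2 := Real.add_one_le_exp (lam * s)
      have h3 : 2 * W / (lam * ς) ≤ s := by linarith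
      have := mul_le_mul_of_nonneg_left h3 hlam.le
      linarith
    have h4 : lam * (2 * W / (lam * ς)) = 2 * W / ς := by field_simp
    rw [h4, div_le_iff₀ hς] at h1
    have h5 : Real.exp (-lam * s) * Real.exp (lam * s) = 1 := by
      rw [← Real.exp_add]; simp
    have hE := Real.exp_pos (-lam * s)
    nlinarith
  have hta' : a' ≤ t := by linarith
  -- The linear barrier that reaches `θ` exactly at time `t`.
  have key := image_le_of_deriv_right_lt_deriv_boundary
    (f := f) (f' := f') (a := a') (b := t)
    (hf.mono (Icc_subset_Icc (by linarith) ht.2))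
    (fun s hs => hf' s ⟨by linarith [hs.1], by linarith [hs.2, ht.2]⟩)
    (B := fun s => θ + ς / 4 * (t - s)) (B' := fun _ => -(ς / 4))
    (by
      have h1 := hup a' ⟨by linarith, by linarith [ht.2]⟩
      have h2 : 4 * (Z₀ + W / lam - θ) / ς ≤ t - a' := by linarith
      rw [div_le_iff₀ hς] at h2
      linarith)
    (by
      intro x
      have h2 := (((hasDerivAt_id x).const_sub t).const_mul (ς / 4)).const_add θ
      simpa using h2)
    (by
      intro x hx hxe
      have hx' : x ∈ Ico a b := ⟨by linarith [hx.1], by linarith [hx.2, ht.2]⟩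
      have hnn : 0 ≤ ς / 4 * (t - x) := mul_nonneg (by positivity) (by linarith [hx.2])
      have h1 := hdec x hx' (by rw [hxe]; linarith) (hup x ⟨hx'.1, hx'.2.le⟩)
      have h2 := hpert x hx.1
      linarith) (right_mem_Icc.2 hta')
  simpa using key

/-- A stable scalar linear equation with a slower exponentially decaying input. -/
theorem le_exp_add_of_deriv_le {a b k lam D W η : ℝ} {f f' : ℝ → ℝ} (hk : 0 < k) (hη : 0 ≤ η)
    (hD : W < (k - lam) * D)
    (hf : ContinuousOn f (Icc a b))
    (hf' : ∀ t ∈ Ico a b, HasDerivWithinAt f (f' t) (Ici t) t)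
    (hfa : f a ≤ D * Real.exp (-lam * a))
    (hdec : ∀ t ∈ Ico a b, f' t ≤ -k * f t + (W * Real.exp (-lam * t) + η)) :
    ∀ t ∈ Icc a b, f t ≤ D * Real.exp (-lam * t) + η / k := by
  intro t ht
  refine image_le_of_deriv_right_lt_deriv_boundary hf hf'
    (B := fun t => D * Real.exp (-lam * t) + η / k)
    (B' := fun t => D * (Real.exp (-lam * t) * (-lam * 1))) ?_ ?_ ?_ ht
  · have : 0 ≤ η / k := by positivity
    linarith
  · intro x
    exact (((hasDerivAt_id x).const_mul (-lam)).exp.const_mul D).add_const _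
  · intro x hx hxe
    have h1 := hdec x hx
    rw [hxe] at h1
    have hE := Real.exp_pos (-lam * x)
    have h2 : k * (η / k) = η := by field_simp
    nlinarith [mul_lt_mul_of_pos_right hD hE]

/-- Grönwall's inequality for the maximum of two functions, where the differential inequality is
only known for a function that attains the maximum. -/
theorem max_le_of_deriv_le {b μ δ₀ δ D : ℝ} {f₁ f₂ f₁' f₂' : ℝ → ℝ} (hμ : 0 < μ) (hδ : δ₀ < δ)
    (hc₁ : ContinuousOn f₁ (Icc 0 b)) (hc₂ : ContinuousOn f₂ (Icc 0 b))
    (hf₁ : ∀ t ∈ Ico 0 b, HasDerivWithinAt f₁ (f₁' t) (Ici t) t)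
    (hf₂ : ∀ t ∈ Ico 0 b, HasDerivWithinAt f₂ (f₂' t) (Ici t) t)
    (h₁ : ∀ t ∈ Ico 0 b, f₂ t ≤ f₁ t → f₁' t ≤ -μ * f₁ t + δ₀)
    (h₂ : ∀ t ∈ Ico 0 b, f₁ t ≤ f₂ t → f₂' t ≤ -μ * f₂ t + δ₀)
    (h0 : max (f₁ 0) (f₂ 0) ≤ D) :
    ∀ t ∈ Icc 0 b, max (f₁ t) (f₂ t)
      ≤ D * Real.exp (-μ * t) + δ / μ * (1 - Real.exp (-μ * t)) := by
  have aux : ∀ {f : ℝ → ℝ} {f' x r M : ℝ}, HasDerivWithinAt f f' (Ici x) x → f x ≤ M →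
      (f x = M → f' < r) → ∀ᶠ z in 𝓝[>] x, f z - M < r * (z - x) := by
    intro f f' x r M hf hM hr
    rcases hM.eq_or_lt with he | hlt
    · have h1 := ((hasDerivWithinAt_iff_tendsto_slope' (by simp)).1 hf.Ioi_of_Ici).eventually
        (eventually_lt_nhds (hr he))
      filter_upwards [h1, self_mem_nhdsWithin] with z hz hzx
      rw [slope_def_field, div_lt_iff₀ (sub_pos.2 hzx), he] at hz
      exact hz
    · have h1 : Tendsto (fun z => f z - M - r * (z - x)) (𝓝[>] x) (𝓝 (f x - M - r * (x - x))) := by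
        refine Tendsto.sub ((hf.Ioi_of_Ici.continuousWithinAt).tendsto.sub_const M) ?_
        exact (Continuous.tendsto (by fun_prop) x).mono_left nhdsWithin_le_nhds
      have h2 := h1.eventually (eventually_lt_nhds (b := 0) (by simp; linarith))
      filter_upwards [h2] with z hz
      linarith
  intro t ht
  refine image_le_of_liminf_slope_right_lt_deriv_boundary (f := fun t => max (f₁ t) (f₂ t))
    (f' := fun t => -μ * max (f₁ t) (f₂ t) + δ₀) (hc₁.sup hc₂) ?_
    (B := fun t => D * Real.exp (-μ * t) + δ / μ * (1 - Real.exp (-μ * t)))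
    (B' := fun t => D * (Real.exp (-μ * t) * (-μ * 1))
      + δ / μ * -(Real.exp (-μ * t) * (-μ * 1))) ?_ ?_ ?_ ht
  · intro x hx r hr
    refine Eventually.frequently ?_
    have e1 := aux (M := max (f₁ x) (f₂ x)) (r := r) (hf₁ x hx) (le_max_left _ _)
      (fun he => by
        have := h₁ x hx (by rw [he]; exact le_max_right _ _)
        rw [he] at this
        linarith)
    have e2 := aux (M := max (f₁ x) (f₂ x)) (r := r) (hf₂ x hx) (le_max_right _ _)
      (fun he => by
        have := h₂ x hx (by rw [he]; exact le_max_left _ _)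
        rw [he] at this
        linarith)
    filter_upwards [e1, e2, self_mem_nhdsWithin] with z hz1 hz2 hzx
    rw [slope_def_field, div_lt_iff₀ (sub_pos.2 hzx)]
    rcases max_choice (f₁ z) (f₂ z) with h | h <;> rw [h] <;> assumption
  · simpa using h0
  · intro x
    have h1 := ((hasDerivAt_id x).const_mul (-μ)).exp
    exact (h1.const_mul D).add ((h1.const_sub 1).const_mul _)
  · intro x hx hxe
    rw [hxe]
    have : δ / μ * μ = δ := by field_simp
    nlinarith [Real.exp_pos (-μ * x)]

/-! ### A double integrator with nested saturations -/

/-- On a bounded range away from the origin a saturation is bounded away from zero. -/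
theorem IsSaturation.exists_lower_bound {a b : ℝ} {σ : ℝ → ℝ} (h : IsSaturation a b σ) {θ : ℝ}
    (hθ : 0 < θ) (S : ℝ) : ∃ ς > 0, ∀ s, θ ≤ |s| → |s| ≤ S → ς ≤ |σ s| := by
  have hK : IsCompact (Metric.closedBall (0 : ℝ) S ∩ {s | θ ≤ |s|}) :=
    (isCompact_closedBall _ _).inter_right (isClosed_le continuous_const continuous_abs)
  rcases (Metric.closedBall (0 : ℝ) S ∩ {s | θ ≤ |s|}).eq_empty_or_nonempty with he | hne
  · refine ⟨1, one_pos, fun s h1 h2 => ?_⟩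
    have : s ∈ Metric.closedBall (0 : ℝ) S ∩ {s | θ ≤ |s|} := ⟨by simpa using h2, h1⟩
    simp [he] at this
  · obtain ⟨x, hx, hmin⟩ := hK.exists_isMinOn hne (f := fun s => |σ s|)
      (h.smooth.continuous.abs.continuousOn)
    have hx0 : x ≠ 0 := by
      rintro rfl
      have : θ ≤ |(0 : ℝ)| := hx.2
      simp at this
      linarith
    refine ⟨|σ x|, abs_pos.2 fun h0 => ?_, fun s h1 h2 => hmin ⟨by simpa using h2, h1⟩⟩
    have := h.sign x hx0
    simp [h0] at this

theorem IsSaturation.lower_bound_of_monotone {a b : ℝ} {σ : ℝ → ℝ} (h : IsSaturation a b σ)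
    (hmono : Monotone σ) {θ s : ℝ} (hθ : 0 < θ) (hθa : θ ≤ a) (hs : θ ≤ |s|) : θ ≤ |σ s| := by
  rcases abs_cases s with ⟨h1, h2⟩ | ⟨h1, h2⟩
  · have := hmono (show θ ≤ s by linarith)
    rw [h.linear θ (by rwa [abs_of_pos hθ])] at this
    exact this.trans (le_abs_self _)
  · have := hmono (show s ≤ -θ by linarith)
    rw [h.linear (-θ) (by rwa [abs_neg, abs_of_pos hθ])] at this
    exact (le_neg_of_le_neg this).trans (neg_le_abs _)

/-- A saturation has the sign of its argument; `e = ± 1` is that sign. -/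
theorem IsSaturation.sign_mul {a b : ℝ} {σ : ℝ → ℝ} (h : IsSaturation a b σ) {e s : ℝ}
    (he : e = 1 ∨ e = -1) (hs : 0 < e * s) : e * σ s = |σ s| := by
  have h1 := h.sign s (by rintro rfl; simp at hs)
  rcases he with rfl | rfl
  · rw [one_mul] at hs ⊢
    exact (abs_of_pos ((mul_pos_iff_of_pos_left hs).1 h1)).symm
  · rw [neg_one_mul] at hs ⊢
    have : σ s < 0 := by nlinarith
    exact (abs_of_neg this).symm

theorem abs_le_of_sign_mul {x M : ℝ} (h : ∀ e : ℝ, e = 1 ∨ e = -1 → e * x ≤ M) : |x| ≤ M := by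
  have h1 := h 1 (.inl rfl)
  have h2 := h (-1) (.inr rfl)
  exact abs_le.2 ⟨by linarith, by linarith⟩

theorem sign_mul_le_abs {e : ℝ} (he : e = 1 ∨ e = -1) (x : ℝ) : e * x ≤ |x| := by
  rcases he with rfl | rfl
  · simpa using le_abs_self x
  · simpa using neg_le_abs x

set_option maxHeartbeats 1000000 in
/-- A double integrator `ẏ = z`, `m ż = -σ₂ (k₁ / k₂ z + σ₁ (k₂ m z + k₁ y)) + w` with nested
saturations and an input `w` that decays exponentially up to a constant `η`. The functions
`ς₁, ς₂` are lower bounds of the saturations on bounded ranges: `η` has to be small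
compared with them, on a range that depends on the initial state; the gain from `η` to the state
does not depend on the initial state. First `z`, then `u = k₂ m z + k₁ y` enter the range
where the saturations are linear, and there the system is triangular in `(u, z)`, with
rates `k₂` and `k₁ / (k₂ m)`. -/
theorem nested_saturation_bound {m k₁ k₂ a₁ b₁ a₂ b₂ lam W : ℝ} {σ₁ σ₂ ς₁ ς₂ : ℝ → ℝ}
    (hm : 0 < m) (hk₁ : 0 < k₁) (hk₂ : 0 < k₂)
    (hσ₁ : IsSaturation a₁ b₁ σ₁) (hσ₂ : IsSaturation a₂ b₂ σ₂) (hab : b₁ < a₂ / 2)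
    (hς₁ : ∀ S, 0 < ς₁ S) (hς₂ : ∀ S, 0 < ς₂ S)
    (hς₁' : ∀ S s, a₁ ≤ |s| → |s| ≤ S → ς₁ S ≤ |σ₁ s|)
    (hς₂' : ∀ S s, a₂ / 2 - b₁ ≤ |s| → |s| ≤ S → ς₂ S ≤ |σ₂ s|)
    (hlam : 0 < lam) (hlam₁ : lam < k₂) (hlam₂ : lam < k₁ / k₂ / m) (hW : 0 ≤ W) :
    ∃ K : ℝ, 0 ≤ K ∧ ∀ r : ℝ, ∃ C S₁ S₂ : ℝ, ∀ (b η : ℝ) (y z w : ℝ → ℝ), 0 ≤ η →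
      η ≤ ς₁ S₁ / 2 → η ≤ ς₂ S₂ / 2 →
      ContinuousOn y (Icc 0 b) → ContinuousOn z (Icc 0 b) →
      (∀ t ∈ Ico 0 b, HasDerivWithinAt y (z t) (Ici t) t) →
      (∀ t ∈ Ico 0 b, HasDerivWithinAt z
        (m⁻¹ * (-σ₂ (k₁ / k₂ * z t + σ₁ (k₂ * m * z t + k₁ * y t)) + w t)) (Ici t) t) →
      (∀ t ∈ Ico 0 b, |w t| ≤ W * Real.exp (-lam * t) + η) →
      |y 0| ≤ r → |z 0| ≤ r →
      ∀ t ∈ Icc 0 b, |y t| + |z t| ≤ C * Real.exp (-lam * t) + K * η := by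
  have ha₁ := hσ₁.a_pos
  have hb₁ := hσ₁.a_le_b
  set κ := k₁ / k₂ with hκd
  have hκ : 0 < κ := by positivity
  have hκk : k₂ * κ = k₁ := by rw [hκd]; field_simp
  have hκm : 0 < κ / m := by positivity
  refine ⟨2 / κ + (1 + k₂ * m * (2 / κ)) / k₁, by positivity, fun r => ?_⟩
  -- The bounds of the first stage, in which `z` becomes small.
  set θ := a₂ / 2 / κ with hθd
  have hκθ : κ * θ = a₂ / 2 := by rw [hθd]; field_simp
  set Z := max r θ + W / m / lam with hZd
  set S₂ := κ * Z + b₁ with hS₂d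
  obtain ⟨T₁, hT₁, reach₁⟩ := exists_reach_time θ (max r θ) (W / m) lam (ς₂ S₂ / 2 / m)
    (le_max_right _ _) (by positivity) hlam (by have := hς₂ S₂; positivity)
  -- The bounds of the second stage, in which `u = k₂ m z + k₁ y` becomes small.
  set U₀ := max (k₂ * m * Z + k₁ * (r + (Z + 1) * T₁)) a₁ with hU₀d
  set S₁ := U₀ + k₂ * W / lam with hS₁d
  obtain ⟨T₂, hT₂, reach₂⟩ := exists_reach_time a₁ U₀ (k₂ * W) lam (k₂ * (ς₁ S₁ / 2))
    (le_max_right _ _) (by positivity) hlam (by have := hς₁ S₁; positivity)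
  -- The constants of the linear stage.
  set T₃ := T₁ + T₂ with hT₃d
  set D₁ := max (a₁ * Real.exp (lam * T₃)) (k₂ * W / (k₂ - lam) + 1) with hD₁d
  set D₂ := max (θ * Real.exp (lam * T₃)) ((D₁ + W) / m / (κ / m - lam) + 1) with hD₂d
  have hkl : 0 < k₂ - lam := by linarith
  have hκl : 0 < κ / m - lam := by linarith
  have hD₁ : k₂ * W < (k₂ - lam) * D₁ := by
    have h1 : k₂ * W / (k₂ - lam) < D₁ := (lt_add_one _).trans_le (le_max_right _ _)
    rw [div_lt_iff₀ hkl] at h1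
    linarith
  have hD₂ : (D₁ + W) / m < (κ / m - lam) * D₂ := by
    have h1 : (D₁ + W) / m / (κ / m - lam) < D₂ := (lt_add_one _).trans_le (le_max_right _ _)
    rw [div_lt_iff₀ hκl] at h1
    linarith
  have hθ0 : 0 < θ := by
    have : 0 < a₂ := by linarith
    positivity
  have hZ0 : 0 < Z := by
    have h1 := le_max_right r θ
    have : 0 ≤ W / m / lam := by positivity
    linarith
  have hU₀0 : 0 < U₀ := ha₁.trans_le (le_max_right _ _)
  have hS₁0 : 0 < S₁ := by
    have : 0 ≤ k₂ * W / lam := by positivity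
    linarith
  have hD₁0 : 0 < D₁ := lt_of_lt_of_le (by positivity) (le_max_left _ _)
  have hD₂0 : 0 < D₂ := lt_of_lt_of_le (by positivity) (le_max_left _ _)
  refine ⟨max (((S₁ + k₂ * m * Z) / k₁ + Z) * Real.exp (lam * T₃))
    ((D₁ + k₂ * m * D₂) / k₁ + D₂), S₁, S₂, ?_⟩
  intro b η y z w hη hη₁ hη₂ hyc hzc hy hz hw hy0 hz0
  have hexp1 : ∀ t, 0 ≤ t → Real.exp (-lam * t) ≤ 1 := fun t ht =>
    Real.exp_le_one_iff.2 (by nlinarith)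
  set u : ℝ → ℝ := fun t => k₂ * m * z t + k₁ * y t with hud
  have hstage₁ : ∀ t ∈ Icc 0 b, |z t| ≤ Z ∧ (T₁ ≤ t → |z t| ≤ θ) := by
    have hsign : ∀ e : ℝ, e = 1 ∨ e = -1 → ∀ t ∈ Icc 0 b,
        e * z t ≤ Z ∧ (0 + T₁ ≤ t → e * z t ≤ θ) := by
      intro e he
      refine reach₁ 0 b (fun t => e * z t) _ le_rfl (hzc.const_mul e)
        (fun t ht => (hz t ht).const_mul e)
        ((sign_mul_le_abs he _).trans (hz0.trans (le_max_left _ _))) ?_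
      intro t ht h1 h2
      set s := κ * z t + σ₁ (k₂ * m * z t + k₁ * y t) with hs
      have hb := hσ₁.bounded (k₂ * m * z t + k₁ * y t)
      have hes : a₂ / 2 - b₁ ≤ e * s ∧ |s| ≤ S₂ ∧ |s| = e * s := by
        have h3 := mul_le_mul_of_nonneg_left h1 hκ.le
        have h4 := mul_le_mul_of_nonneg_left h2 hκ.le
        rw [hκθ] at h3
        have hb' := abs_le.1 hb
        rcases he with rfl | rfl
        · have hs0 : 0 < s := by rw [hs]; linarith
          rw [abs_of_pos hs0]
          exact ⟨by rw [hs]; linarith, by rw [hs, hS₂d]; linarith, by ring⟩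
        · have hs0 : s < 0 := by rw [hs]; linarith
          rw [abs_of_neg hs0]
          exact ⟨by rw [hs]; linarith, by rw [hs, hS₂d]; linarith, by ring⟩
      have hlow := hς₂' S₂ s (hes.2.2 ▸ hes.1) hes.2.1
      rw [← hσ₂.sign_mul he (by linarith)] at hlow
      have hew := (sign_mul_le_abs he (w t)).trans (hw t ht)
      have h5 : e * (m⁻¹ * (-σ₂ s + w t)) = m⁻¹ * (-(e * σ₂ s) + e * w t) := by ring
      have h6 : -(ς₂ S₂ / 2 / m) + W / m * Real.exp (-lam * t)
        = m⁻¹ * (-(ς₂ S₂ / 2) + W * Real.exp (-lam * t)) := by field_simp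
      rw [h5, h6]
      exact mul_le_mul_of_nonneg_left (by linarith) (by positivity)
    intro t ht
    refine ⟨abs_le_of_sign_mul fun e he => (hsign e he t ht).1, fun hT =>
      abs_le_of_sign_mul fun e he => (hsign e he t ht).2 (by linarith)⟩
  have hygrow : ∀ t ∈ Icc 0 b, |y t| ≤ r + (Z + 1) * t := by
    intro t ht
    refine abs_le_of_sign_mul fun e he => ?_
    refine image_le_of_deriv_right_lt_deriv_boundary (f := fun t => e * y t)
      (B := fun t => r + (Z + 1) * t) (B' := fun _ => (Z + 1) * 1) (hyc.const_mul e)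
      (fun t ht => (hy t ht).const_mul e) ?_
      (fun x => ((hasDerivAt_id x).const_mul _).const_add _) ?_ ht
    · simpa using (sign_mul_le_abs he _).trans hy0
    · intro x hx _
      have := (sign_mul_le_abs he _).trans (hstage₁ x ⟨hx.1, hx.2.le⟩).1
      linarith
  have hu_of : ∀ t, |u t| ≤ k₂ * m * |z t| + k₁ * |y t| := by
    intro t
    refine (abs_add_le _ _).trans ?_
    rw [abs_mul (k₂ * m), abs_mul k₁, abs_of_pos hk₁, abs_of_pos (mul_pos hk₂ hm)]
  have hy_of : ∀ t, |y t| ≤ (|u t| + k₂ * m * |z t|) / k₁ := by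
    intro t
    rw [le_div_iff₀ hk₁]
    have h1 : k₁ * y t = u t - k₂ * m * z t := by simp only [hud]; ring
    have h2 := abs_sub (u t) (k₂ * m * z t)
    rw [← h1, abs_mul k₁, abs_mul (k₂ * m), abs_of_pos hk₁, abs_of_pos (mul_pos hk₂ hm)] at h2
    linarith
  have huearly : ∀ t ∈ Icc 0 b, t ≤ T₁ → |u t| ≤ U₀ := by
    intro t ht htT
    refine (hu_of t).trans (le_trans ?_ (le_max_left _ _))
    have h1 := (hstage₁ t ht).1
    have h2 := hygrow t ht
    have h3 : (Z + 1) * t ≤ (Z + 1) * T₁ := mul_le_mul_of_nonneg_left htT (by linarith)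
    gcongr
    linarith
  have hu' : ∀ t ∈ Ico 0 b, T₁ ≤ t →
      HasDerivWithinAt u (k₂ * (-σ₁ (u t) + w t)) (Ici t) t := by
    intro t ht hT
    have h1 := ((hz t ht).const_mul (k₂ * m)).add ((hy t ht).const_mul k₁)
    refine h1.congr_deriv ?_
    have h2 := (hstage₁ t ⟨ht.1, ht.2.le⟩).2 hT
    have h3 : σ₂ (κ * z t + σ₁ (k₂ * m * z t + k₁ * y t))
        = κ * z t + σ₁ (k₂ * m * z t + k₁ * y t) := by
      refine hσ₂.linear _ ((abs_add_le _ _).trans ?_)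
      rw [abs_mul, abs_of_pos hκ]
      have h4 := mul_le_mul_of_nonneg_left h2 hκ.le
      have h5 := hσ₁.bounded (k₂ * m * z t + k₁ * y t)
      linarith
    rw [h3, ← hκk]
    simp only [hud, ← hκk]
    field_simp
    ring
  have huc : ContinuousOn u (Icc 0 b) := (hzc.const_mul _).add (hyc.const_mul _)
  have hstage₂ : ∀ t ∈ Icc 0 b, T₁ ≤ t → |u t| ≤ S₁ ∧ (T₃ ≤ t → |u t| ≤ a₁) := by
    intro t ht hT
    have hsign : ∀ e : ℝ, e = 1 ∨ e = -1 →
        e * u t ≤ S₁ ∧ (T₁ + T₂ ≤ t → e * u t ≤ a₁) := by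
      intro e he
      refine reach₂ T₁ b (fun t => e * u t) _ hT₁
        ((huc.mono (Icc_subset_Icc_left hT₁)).const_mul e)
        (fun t ht => (hu' t ⟨hT₁.trans ht.1, ht.2⟩ ht.1).const_mul e)
        ((sign_mul_le_abs he _).trans (huearly T₁ ⟨hT₁, hT.trans ht.2⟩ le_rfl)) ?_ t ⟨hT, ht.2⟩
      intro t ht h1 h2
      have hlow := hς₁' S₁ (u t) (h1.trans (sign_mul_le_abs he _)) (by
        rcases he with rfl | rfl
        · rw [abs_of_pos (by linarith)]; linarith
        · rw [abs_of_neg (by linarith)]; linarith)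
      rw [← hσ₁.sign_mul he (by linarith)] at hlow
      have hew := (sign_mul_le_abs he (w t)).trans (hw t ⟨hT₁.trans ht.1, ht.2⟩)
      have h5 : e * (k₂ * (-σ₁ (u t) + w t)) = k₂ * (-(e * σ₁ (u t)) + e * w t) := by ring
      have h6 : -(k₂ * (ς₁ S₁ / 2)) + k₂ * W * Real.exp (-lam * t)
        = k₂ * (-(ς₁ S₁ / 2) + W * Real.exp (-lam * t)) := by ring
      rw [h5, h6]
      exact mul_le_mul_of_nonneg_left (by linarith) hk₂.le
    exact ⟨abs_le_of_sign_mul fun e he => (hsign e he).1, fun hT =>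
      abs_le_of_sign_mul fun e he => (hsign e he).2 hT⟩
  have hT₃ : 0 ≤ T₃ := add_nonneg hT₁ hT₂
  have hT₁₃ : T₁ ≤ T₃ := by linarith
  have hee : Real.exp (lam * T₃) * Real.exp (-lam * T₃) = 1 := by
    rw [← Real.exp_add]; simp
  have hstage₃ : ∀ t ∈ Icc T₃ b, |u t| ≤ D₁ * Real.exp (-lam * t) + η := by
    intro t ht
    refine abs_le_of_sign_mul fun e he => ?_
    have key := le_exp_add_of_deriv_le (a := T₃) (b := b) (k := k₂) (lam := lam) (D := D₁)
      (W := k₂ * W) (η := k₂ * η) (f := fun t => e * u t) hk₂ (by positivity) hD₁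
      ((huc.mono (Icc_subset_Icc_left hT₃)).const_mul e)
      (fun t ht => (hu' t ⟨hT₃.trans ht.1, ht.2⟩ (hT₁₃.trans ht.1)).const_mul e)
      (by
        refine (sign_mul_le_abs he _).trans
          (((hstage₂ T₃ ⟨hT₃, ht.1.trans ht.2⟩ hT₁₃).2 le_rfl).trans ?_)
        have := mul_le_mul_of_nonneg_right (le_max_left (a₁ * Real.exp (lam * T₃))
          (k₂ * W / (k₂ - lam) + 1)) (Real.exp_pos (-lam * T₃)).le
        rwa [mul_assoc, hee, mul_one] at this)
      (by
        intro t ht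
        have h0 := (hstage₂ t ⟨hT₃.trans ht.1, ht.2.le⟩ (hT₁₃.trans ht.1)).2 ht.1
        have hew := (sign_mul_le_abs he (w t)).trans (hw t ⟨hT₃.trans ht.1, ht.2⟩)
        rw [hσ₁.linear _ h0]
        have := mul_le_mul_of_nonneg_left hew hk₂.le
        linarith) t ht
    rwa [mul_div_cancel_left₀ _ hk₂.ne'] at key
  have hstage₄ : ∀ t ∈ Icc T₃ b, |z t| ≤ D₂ * Real.exp (-lam * t) + 2 / κ * η := by
    intro t ht
    refine abs_le_of_sign_mul fun e he => ?_
    have key := le_exp_add_of_deriv_le (a := T₃) (b := b) (k := κ / m) (lam := lam) (D := D₂)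
      (W := (D₁ + W) / m) (η := 2 * η / m) (f := fun t => e * z t) hκm (by positivity) hD₂
      ((hzc.mono (Icc_subset_Icc_left hT₃)).const_mul e)
      (fun t ht => (hz t ⟨hT₃.trans ht.1, ht.2⟩).const_mul e)
      (by
        refine (sign_mul_le_abs he _).trans
          (((hstage₁ T₃ ⟨hT₃, ht.1.trans ht.2⟩).2 hT₁₃).trans ?_)
        have := mul_le_mul_of_nonneg_right (le_max_left (θ * Real.exp (lam * T₃))
          ((D₁ + W) / m / (κ / m - lam) + 1)) (Real.exp_pos (-lam * T₃)).le
        rwa [mul_assoc, hee, mul_one] at this)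
      (by
        intro t ht
        have ht0 : t ∈ Icc 0 b := ⟨hT₃.trans ht.1, ht.2.le⟩
        have h0 := (hstage₂ t ht0 (hT₁₃.trans ht.1)).2 ht.1
        have hew := (sign_mul_le_abs he (w t)).trans (hw t ⟨hT₃.trans ht.1, ht.2⟩)
        have heu : -(e * u t) ≤ D₁ * Real.exp (-lam * t) + η := by
          have h1 := hstage₃ t ⟨ht.1, ht.2.le⟩
          have h2 := sign_mul_le_abs (e := -e) (by rcases he with rfl | rfl <;> simp) (u t)
          linarith
        have h2 := (hstage₁ t ht0).2 (hT₁₃.trans ht.1)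
        have h3 : σ₂ (κ * z t + σ₁ (k₂ * m * z t + k₁ * y t)) = κ * z t + u t := by
          rw [show k₂ * m * z t + k₁ * y t = u t from rfl, hσ₁.linear _ h0]
          refine hσ₂.linear _ ((abs_add_le _ _).trans ?_)
          rw [abs_mul, abs_of_pos hκ]
          have h4 := mul_le_mul_of_nonneg_left h2 hκ.le
          linarith
        rw [h3]
        have h5 : e * (m⁻¹ * (-(κ * z t + u t) + w t))
            = -(κ / m) * (e * z t) + m⁻¹ * (-(e * u t) + e * w t) := by field_simp; ring
        have h6 : (D₁ + W) / m * Real.exp (-lam * t) + 2 * η / m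
            = m⁻¹ * ((D₁ * Real.exp (-lam * t) + η) + (W * Real.exp (-lam * t) + η)) := by
          field_simp; ring
        rw [h5, h6]
        have := mul_le_mul_of_nonneg_left (add_le_add heu hew) (inv_pos.2 hm).le
        linarith) t ht
    have h7 : 2 * η / m / (κ / m) = 2 / κ * η := by field_simp
    rwa [h7] at key
  intro t ht
  have hE := Real.exp_pos (-lam * t)
  have hKη : 0 ≤ (2 / κ + (1 + k₂ * m * (2 / κ)) / k₁) * η := by positivity
  rcases le_total t T₃ with htT | htT
  · have hz1 := (hstage₁ t ht).1
    have hu1 : |u t| ≤ S₁ := by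
      rcases le_total t T₁ with h | h
      · have := huearly t ht h
        have h' : 0 ≤ k₂ * W / lam := by positivity
        linarith
      · exact (hstage₂ t ht h).1
    have hy1 : |y t| ≤ (S₁ + k₂ * m * Z) / k₁ := (hy_of t).trans (by gcongr)
    have h1 : 1 ≤ Real.exp (lam * T₃) * Real.exp (-lam * t) := by
      rw [← Real.exp_add]
      exact Real.one_le_exp (by nlinarith)
    have h2 := mul_le_mul_of_nonneg_right (le_max_left
      (((S₁ + k₂ * m * Z) / k₁ + Z) * Real.exp (lam * T₃)) ((D₁ + k₂ * m * D₂) / k₁ + D₂)) hE.le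
    have h3 : 0 ≤ (S₁ + k₂ * m * Z) / k₁ + Z := by positivity
    nlinarith
  · have hu1 := hstage₃ t ⟨htT, ht.2⟩
    have hz1 := hstage₄ t ⟨htT, ht.2⟩
    have hy1 : |y t| ≤ ((D₁ * Real.exp (-lam * t) + η)
        + k₂ * m * (D₂ * Real.exp (-lam * t) + 2 / κ * η)) / k₁ := (hy_of t).trans (by gcongr)
    have h2 := mul_le_mul_of_nonneg_right (le_max_right
      (((S₁ + k₂ * m * Z) / k₁ + Z) * Real.exp (lam * T₃)) ((D₁ + k₂ * m * D₂) / k₁ + D₂)) hE.le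
    have h3 : ((D₁ * Real.exp (-lam * t) + η)
        + k₂ * m * (D₂ * Real.exp (-lam * t) + 2 / κ * η)) / k₁
        + (D₂ * Real.exp (-lam * t) + 2 / κ * η)
        = ((D₁ + k₂ * m * D₂) / k₁ + D₂) * Real.exp (-lam * t)
          + (2 / κ + (1 + k₂ * m * (2 / κ)) / k₁) * η := by
      ring
    linarith

/-! ### Geometry of the reduced attitude -/

theorem cross_cross_left (a b : E3) : cross a (cross a b) = ⟪b, a⟫ • a - ⟪a, a⟫ • b := by
  ext i
  fin_cases i <;>
    simp [cross, cross_apply, PiLp.inner_apply, Fin.sum_univ_three,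
      -inner_self_eq_norm_sq_to_K] <;> ring

theorem transport_eq (q qd w : E3) : transport q qd w = ⟪qd, q⟫ • w - ⟪w, q⟫ • qd := by
  ext i
  fin_cases i <;>
    simp [transport, cross, cross_apply, PiLp.inner_apply, Fin.sum_univ_three] <;> ring

theorem inner_bodyAxis (R : SO3) (i j : Fin 3) :
    ⟪bodyAxis R i, bodyAxis R j⟫ = if i = j then 1 else 0 := by
  have h := congrFun (congrFun ((Matrix.mem_orthogonalGroup_iff' _ _).1
    (Matrix.mem_specialOrthogonalGroup_iff.1 R.2).1) j) i
  simp only [Matrix.mul_apply, Matrix.transpose_apply, Matrix.one_apply] at h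
  simp only [bodyAxis, PiLp.inner_apply, RCLike.inner_apply, conj_trivial, eq_comm (a := i)]
  exact h

theorem sum_inner_bodyAxis_mul (R : SO3) (a b : E3) :
    ∑ i, ⟪bodyAxis R i, a⟫ * ⟪bodyAxis R i, b⟫ = ⟪a, b⟫ := by
  have h : ∀ k l : Fin 3, ∑ i, R.1 k i * R.1 l i = if k = l then 1 else 0 := by
    intro k l
    have h := congrFun (congrFun ((Matrix.mem_orthogonalGroup_iff _ _).1
      (Matrix.mem_specialOrthogonalGroup_iff.1 R.2).1) k) l
    simpa only [Matrix.mul_apply, Matrix.transpose_apply, Matrix.one_apply] using h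
  have h' : ∑ i, ⟪bodyAxis R i, a⟫ * ⟪bodyAxis R i, b⟫
      = ∑ k, ∑ l, a k * b l * ∑ i, R.1 k i * R.1 l i := by
    simp [bodyAxis, PiLp.inner_apply, Fin.sum_univ_three]
    ring
  rw [h']
  simp [h, PiLp.inner_apply, mul_comm]

theorem norm_bodyAxis (R : SO3) (i : Fin 3) : ‖bodyAxis R i‖ = 1 := by
  have h := inner_bodyAxis R i i
  rw [real_inner_self_eq_norm_sq, if_pos rfl] at h
  exact (pow_eq_one_iff_of_nonneg (norm_nonneg _) two_ne_zero).1 h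

theorem inner_horizontal (R : SO3) (a b : E3) :
    ⟪horizontal R a, horizontal R b⟫
      = ⟪a, b⟫ - ⟪bodyAxis R 2, a⟫ * ⟪bodyAxis R 2, b⟫ := by
  rw [← sum_inner_bodyAxis_mul R a b]
  simp only [horizontal, PiLp.inner_apply (𝕜 := ℝ) (ι := Fin 2), Fin.sum_univ_three,
    Fin.sum_univ_two, RCLike.inner_apply, conj_trivial, Matrix.cons_val_zero,
    Matrix.cons_val_one]
  ring

theorem horizontal_sub (R : SO3) (a b : E3) :
    horizontal R (a - b) = horizontal R a - horizontal R b := by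
  ext i
  fin_cases i <;>  simp [horizontal, inner_sub_right]
  all_goals ring

theorem horizontal_smul (R : SO3) (c : ℝ) (a : E3) :
    horizontal R (c • a) = c • horizontal R a := by
  ext i
  fin_cases i <;> simp [horizontal, inner_smul_right]

/-- The velocity `Ω₂ r₁ - Ω₁ r₂` of the reduced attitude, in body coordinates. -/
theorem horizontal_velocity (R : SO3) (Ω : E3) :
    horizontal R (Ω 1 • bodyAxis R 0 - Ω 0 • bodyAxis R 1) = horiz Ω := by
  ext i
  fin_cases i <;> simp [horizontal, horiz, inner_sub_right, inner_smul_right, inner_bodyAxis,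
    -inner_self_eq_norm_sq_to_K]

section AttitudeError

variable {q qd : E3}

theorem Psi_lt_two_iff : Psi q qd < 2 ↔ 0 < 1 + ⟪qd, q⟫ := by
  have h2 : (0 : ℝ) < 2 / √2 := by positivity
  rw [Psi, sub_lt_self_iff, mul_pos_iff_of_pos_left h2, Real.sqrt_pos]

theorem inner_mem_Icc (hq : ‖q‖ = 1) (hqd : ‖qd‖ = 1) : ⟪qd, q⟫ ∈ Icc (-1 : ℝ) 1 := by
  have := abs_real_inner_le_norm qd q
  rw [hq, hqd, one_mul] at this
  exact abs_le.1 this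

theorem attErr_eq (hq : ‖q‖ = 1) :
    attErr q qd = (1 / (√2 * √(1 + ⟪qd, q⟫))) • (⟪qd, q⟫ • q - qd) := by
  rw [attErr, cross_cross_left, real_inner_self_eq_norm_sq q, hq]
  simp

theorem inner_attErr_left (hq : ‖q‖ = 1) : ⟪q, attErr q qd⟫ = 0 := by
  rw [attErr_eq hq, inner_smul_right, inner_sub_right, inner_smul_right,
    real_inner_self_eq_norm_sq, hq, real_inner_comm]
  simp

theorem norm_sq_projection (hq : ‖q‖ = 1) (hqd : ‖qd‖ = 1) :
    ‖⟪qd, q⟫ • q - qd‖ ^ 2 = 1 - ⟪qd, q⟫ ^ 2 := by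
  rw [norm_sub_sq_real, norm_smul, hq, hqd, inner_smul_left, real_inner_comm, mul_one,
    Real.norm_eq_abs, sq_abs]
  simp
  ring

theorem norm_attErr_sq (hq : ‖q‖ = 1) (hqd : ‖qd‖ = 1) (h : 0 < 1 + ⟪qd, q⟫) :
    ‖attErr q qd‖ ^ 2 = (1 - ⟪qd, q⟫) / 2 := by
  rw [attErr_eq hq, norm_smul, mul_pow, norm_sq_projection hq hqd, Real.norm_eq_abs, sq_abs,
    div_pow, mul_pow, Real.sq_sqrt zero_le_two, Real.sq_sqrt h.le]
  field_simp
  ring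

theorem Psi_nonneg (hq : ‖q‖ = 1) (hqd : ‖qd‖ = 1) : 0 ≤ Psi q qd := by
  have h1 : √(1 + ⟪qd, q⟫) ≤ √2 := Real.sqrt_le_sqrt (by linarith [(inner_mem_Icc hq hqd).2])
  have h2 : 2 / √2 * √(1 + ⟪qd, q⟫) ≤ 2 / √2 * √2 := by gcongr
  have h3 : 2 / √2 * √2 = 2 := by field_simp
  rw [Psi]
  linarith

theorem Psi_le_two : Psi q qd ≤ 2 := by
  rw [Psi]
  have : 0 ≤ 2 / √2 * √(1 + ⟪qd, q⟫) := by positivity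
  linarith

/-- With `θ` the angle between `q` and `q_d`: `Ψ = 2 - 2 cos (θ / 2)` and
`‖e_q‖ = sin (θ / 2)`. -/
theorem norm_attErr_sq_eq_Psi (hq : ‖q‖ = 1) (hqd : ‖qd‖ = 1) (h : 0 < 1 + ⟪qd, q⟫) :
    ‖attErr q qd‖ ^ 2 = Psi q qd * (1 - Psi q qd / 4) := by
  rw [norm_attErr_sq hq hqd h, Psi]
  have h1 := Real.sq_sqrt h.le
  have h2 := Real.sq_sqrt (zero_le_two (α := ℝ))
  have h3 : (2 / √2) ^ 2 = 2 := by rw [div_pow, h2]; norm_num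
  linear_combination (1 / 4) * (2 / √2) ^ 2 * h1 + (1 + ⟪qd, q⟫) / 4 * h3

theorem norm_attErr_sq_le_Psi (hq : ‖q‖ = 1) (hqd : ‖qd‖ = 1) (h : 0 < 1 + ⟪qd, q⟫) :
    ‖attErr q qd‖ ^ 2 ≤ Psi q qd := by
  rw [norm_attErr_sq_eq_Psi hq hqd h]
  nlinarith [Psi_nonneg hq hqd]

theorem Psi_le_norm_attErr_sq (hq : ‖q‖ = 1) (hqd : ‖qd‖ = 1) (h : 0 < 1 + ⟪qd, q⟫) :
    Psi q qd / 2 ≤ ‖attErr q qd‖ ^ 2 := by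
  rw [norm_attErr_sq_eq_Psi hq hqd h]
  nlinarith [Psi_nonneg hq hqd, Psi_le_two (q := q) (qd := qd)]

theorem norm_attErr_le_one (hq : ‖q‖ = 1) (hqd : ‖qd‖ = 1) (h : 0 < 1 + ⟪qd, q⟫) :
    ‖attErr q qd‖ ≤ 1 := by
  have h1 := norm_attErr_sq hq hqd h
  have h2 := (inner_mem_Icc hq hqd).1
  exact (sq_le_one_iff₀ (norm_nonneg _)).1 (by linarith)

theorem norm_projection_le (hq : ‖q‖ = 1) (hqd : ‖qd‖ = 1) (h : 0 < 1 + ⟪qd, q⟫) :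
    ‖⟪qd, q⟫ • q - qd‖ ≤ 2 * ‖attErr q qd‖ := by
  refine abs_le_of_sq_le_sq' ?_ (by positivity) |>.2
  rw [norm_sq_projection hq hqd, mul_pow, norm_attErr_sq hq hqd h]
  nlinarith [(inner_mem_Icc hq hqd).2, (inner_mem_Icc hq hqd).1]

theorem norm_horizontal_attErr (R : SO3) :
    ‖horizontal R (attErr (bodyAxis R 2) qd)‖ = ‖attErr (bodyAxis R 2) qd‖ := by
  have h := inner_horizontal R (attErr (bodyAxis R 2) qd) (attErr (bodyAxis R 2) qd)
  rw [inner_attErr_left (norm_bodyAxis R 2), real_inner_self_eq_norm_sq,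
    real_inner_self_eq_norm_sq, mul_zero, sub_zero] at h
  exact (sq_eq_sq₀ (norm_nonneg _) (norm_nonneg _)).1 h

/-- The error vector is compatible with the transport map: the derivative of `Ψ` in the direction
`(v, w)`, tangent to the product of two spheres, is `⟨e_q, v - T(q, q_d) w⟩`. -/
theorem inner_attErr_sub_transport (hq : ‖q‖ = 1) (hqd : ‖qd‖ = 1) {v w : E3}
    (hv : ⟪q, v⟫ = 0) (hw : ⟪qd, w⟫ = 0) :
    ⟪attErr q qd, v - transport q qd w⟫
      = -(1 / (√2 * √(1 + ⟪qd, q⟫)) * (⟪qd, v⟫ + ⟪w, q⟫)) := by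
  rw [attErr_eq hq, transport_eq]
  simp only [inner_smul_left, inner_sub_left, inner_sub_right, inner_smul_right, hv, hw,
    real_inner_self_eq_norm_sq, hqd, real_inner_comm qd q, real_inner_comm w q]
  simp
  ring

end AttitudeError

/-! ### Smoothness of the control law along a motion -/

namespace Params

variable {p : Params}

theorem contDiff_fhat (hσ₁ : ContDiff ℝ ∞ p.σ₁) (hσ₂ : ContDiff ℝ ∞ p.σ₂)
    (hxd : ContDiff ℝ ∞ p.xd) :
    ContDiff ℝ ∞ (fun z : ℝ × E3 × E3 => p.fhat z.1 z.2.1 z.2.2) := by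
  have h0 : ContDiff ℝ ∞ (fun z : ℝ × E3 × E3 => p.xd z.1) := hxd.comp contDiff_fst
  have h1 : ContDiff ℝ ∞ (fun z : ℝ × E3 × E3 => deriv p.xd z.1) :=
    (hxd.iterate_deriv 1).comp contDiff_fst
  have h2 : ContDiff ℝ ∞ (fun z : ℝ × E3 × E3 => iteratedDeriv 2 p.xd z.1) := by
    rw [iteratedDeriv_eq_iterate]
    exact (hxd.iterate_deriv 2).comp contDiff_fst
  have hx : ContDiff ℝ ∞ (fun z : ℝ × E3 × E3 => z.2.1 - p.xd z.1) :=
    (contDiff_fst.comp contDiff_snd).sub h0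
  have hv : ContDiff ℝ ∞ (fun z : ℝ × E3 × E3 => z.2.2 - deriv p.xd z.1) :=
    (contDiff_snd.comp contDiff_snd).sub h1
  have hx' := fun i => contDiff_euclidean.1 hx i
  have hv' := fun i => contDiff_euclidean.1 hv i
  refine ContDiff.add (contDiff_euclidean.2 fun i => ?_)
    ((h2.const_smul p.m).add contDiff_const)
  exact (hσ₂.comp ((contDiff_const.mul (hv' i)).add
    (hσ₁.comp ((contDiff_const.mul (hv' i)).add (contDiff_const.mul (hx' i)))))).neg

theorem contDiffAt_qd (hF : ContDiff ℝ ∞ (fun z : ℝ × E3 × E3 => p.fhat z.1 z.2.1 z.2.2))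
    {z : ℝ × E3 × E3} (hz : p.fhat z.1 z.2.1 z.2.2 ≠ 0) :
    ContDiffAt ℝ ∞ (fun z : ℝ × E3 × E3 => p.qd z.1 z.2.1 z.2.2) z :=
  ((hF.contDiffAt.norm ℝ hz).inv (norm_ne_zero_iff.2 hz)).smul hF.contDiffAt

theorem norm_qd {t : ℝ} {x v : E3} (h : p.fhat t x v ≠ 0) : ‖p.qd t x v‖ = 1 := by
  rw [qd, norm_smul, norm_inv, norm_norm, inv_mul_cancel₀ (norm_ne_zero_iff.2 h)]

end Params

theorem differentiableWithinAt_cross {f g : ℝ → E3} {I : Set ℝ} {t : ℝ}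
    (hf : DifferentiableWithinAt ℝ f I t) (hg : DifferentiableWithinAt ℝ g I t) :
    DifferentiableWithinAt ℝ (fun s => cross (f s) (g s)) I t := by
  have hf' := differentiableWithinAt_euclidean.1 hf
  have hg' := differentiableWithinAt_euclidean.1 hg
  refine differentiableWithinAt_euclidean.2 fun i => ?_
  fin_cases i <;> simp only [cross, cross_apply] <;>
  exact ((hf' _).mul (hg' _)).sub ((hf' _).mul (hg' _))

theorem differentiableWithinAt_horizontal {R : ℝ → SO3} {y : ℝ → E3} {I : Set ℝ} {t : ℝ}
    (hR : ∀ j, DifferentiableWithinAt ℝ (fun s => bodyAxis (R s) j) I t)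
    (hy : DifferentiableWithinAt ℝ y I t) :
    DifferentiableWithinAt ℝ (fun s => horizontal (R s) (y s)) I t := by
  refine differentiableWithinAt_euclidean.2 fun i => ?_
  fin_cases i
  · exact ((hR 1).inner ℝ hy).neg
  · exact (hR 0).inner ℝ hy

theorem differentiableWithinAt_attErr {q qd : ℝ → E3} {I : Set ℝ} {t : ℝ}
    (hq : DifferentiableWithinAt ℝ q I t) (hqd : DifferentiableWithinAt ℝ qd I t)
    (h : 0 < 1 + ⟪qd t, q t⟫) :
    DifferentiableWithinAt ℝ (fun s => attErr (q s) (qd s)) I t := by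
  have h1 : DifferentiableWithinAt ℝ (fun s => √(1 + ⟪qd s, q s⟫)) I t :=
    ((hqd.inner ℝ hq).const_add 1).sqrt h.ne'
  have h2 : √2 * √(1 + ⟪qd t, q t⟫) ≠ 0 :=
    (mul_pos (by positivity) (Real.sqrt_pos.2 h)).ne'
  exact (((differentiableWithinAt_const 1).div (h1.const_mul (√2)) h2)).smul
    (differentiableWithinAt_cross hq (differentiableWithinAt_cross hq hqd))

section Motion

variable {p : Params} {tol : ℝ} {I : Set ℝ} {d : ℝ → E2} {τ : ℝ → ℝ} {X : Motion}

theorem IsClosedLoop.hasDerivWithinAt_bodyAxis (hX : IsClosedLoop p tol I d τ X) {t : ℝ}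
    (ht : t ∈ I) (j : Fin 3) :
    HasDerivWithinAt (fun s => bodyAxis (X.R s) j)
      (WithLp.toLp 2 fun k => ((X.R t).1 * hat (X.Ω t)) k j) I t := by
  have h := hasDerivWithinAt_pi.2 fun k => hX.att t ht k j
  exact ((PiLp.continuousLinearEquiv 2 ℝ
    (fun _ : Fin 3 => ℝ)).symm.hasFDerivAt.comp_hasDerivWithinAt t h)

/-- The reduced attitude moves by `q̇ = Ω₂ r₁ - Ω₁ r₂`. -/
theorem IsClosedLoop.hasDerivWithinAt_q (hX : IsClosedLoop p tol I d τ X) {t : ℝ} (ht : t ∈ I) :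
    HasDerivWithinAt X.q (X.Ω t 1 • bodyAxis (X.R t) 0 - X.Ω t 0 • bodyAxis (X.R t) 1) I t := by
  refine (hX.hasDerivWithinAt_bodyAxis ht 2).congr_deriv ?_
  ext k
  simp [bodyAxis, hat, Matrix.mul_apply, Fin.sum_univ_three]
  ring

theorem IsClosedLoop.hasDerivWithinAt_state (hX : IsClosedLoop p tol I d τ X) {t : ℝ}
    (ht : t ∈ I) :
    HasDerivWithinAt (fun t => (t, X.x t, X.v t)) (1, X.v t,
      p.m⁻¹ • (-(p.m * p.g) • e3
        + p.netThrust t (X.x t) (X.v t) (X.R t) • bodyAxis (X.R t) 2)) I t :=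
  (hasDerivWithinAt_id t I).prodMk ((hX.pos t ht).prodMk (hX.vel t ht))

theorem IsClosedLoop.differentiableWithinAt_acceleration (hX : IsClosedLoop p tol I d τ X)
    (hF : ContDiff ℝ ∞ (fun z : ℝ × E3 × E3 => p.fhat z.1 z.2.1 z.2.2)) {t : ℝ} (ht : t ∈ I) :
    DifferentiableWithinAt ℝ (fun t => p.m⁻¹ • (-(p.m * p.g) • e3
      + p.netThrust t (X.x t) (X.v t) (X.R t) • bodyAxis (X.R t) 2)) I t := by
  have hq : DifferentiableWithinAt ℝ (fun s => bodyAxis (X.R s) 2) I t :=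
    (hX.hasDerivWithinAt_bodyAxis ht 2).differentiableWithinAt
  have hf : DifferentiableWithinAt ℝ (fun t => p.fhat t (X.x t) (X.v t)) I t :=
    DifferentiableAt.comp_differentiableWithinAt (f := fun t => (t, X.x t, X.v t))
      (g := fun z : ℝ × E3 × E3 => p.fhat z.1 z.2.1 z.2.2) t
      (hF.differentiable (by simp)).differentiableAt
      (hX.hasDerivWithinAt_state ht).differentiableWithinAt
  exact (((hf.inner ℝ hq).smul hq).const_add (-(p.m * p.g) • e3)).const_smul p.m⁻¹

/-- The curve `t ↦ (t, x, v)` has a derivative that is itself differentiable. -/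
theorem IsClosedLoop.exists_deriv_state (hX : IsClosedLoop p tol I d τ X)
    (hF : ContDiff ℝ ∞ (fun z : ℝ × E3 × E3 => p.fhat z.1 z.2.1 z.2.2)) :
    ∃ s' : ℝ → ℝ × E3 × E3,
      (∀ t ∈ I, HasDerivWithinAt (fun t => (t, X.x t, X.v t)) (s' t) I t) ∧
        DifferentiableOn ℝ s' I :=
  ⟨fun _ => (1, _, _), fun _ ht => hX.hasDerivWithinAt_state ht, fun t ht =>
    (differentiableWithinAt_const 1).prodMk ((hX.vel t ht).differentiableWithinAt.prodMk
      (hX.differentiableWithinAt_acceleration hF ht))⟩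

theorem IsClosedLoop.differentiable_qd (hX : IsClosedLoop p tol I d τ X)
    (hF : ContDiff ℝ ∞ (fun z : ℝ × E3 × E3 => p.fhat z.1 z.2.1 z.2.2))
    (h0 : ∀ t ∈ I, p.fhat t (X.x t) (X.v t) ≠ 0) (hI : UniqueDiffOn ℝ I) :
    DifferentiableOn ℝ (X.qd p) I ∧ DifferentiableOn ℝ (derivWithin (X.qd p) I) I := by
  obtain ⟨s', hs, hs'⟩ := hX.exists_deriv_state hF
  set G : ℝ × E3 × E3 → E3 := fun z => p.qd z.1 z.2.1 z.2.2 with hG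
  have hGs : ∀ t ∈ I, ContDiffAt ℝ ∞ G (t, X.x t, X.v t) := fun t ht =>
    Params.contDiffAt_qd hF (h0 t ht)
  have hd : ∀ t ∈ I, HasDerivWithinAt (X.qd p) (fderiv ℝ G (t, X.x t, X.v t) (s' t)) I t :=
    fun t ht => HasFDerivAt.comp_hasDerivWithinAt (f := fun t => (t, X.x t, X.v t)) (l := G) t
      ((hGs t ht).differentiableAt (by simp)).hasFDerivAt (hs t ht)
  refine ⟨fun t ht => (hd t ht).differentiableWithinAt, ?_⟩
  refine DifferentiableOn.congr (f := fun t => fderiv ℝ G (t, X.x t, X.v t) (s' t)) ?_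
    fun t ht => (hd t ht).derivWithin (hI t ht)
  intro t ht
  refine DifferentiableWithinAt.clm_apply ?_ (hs' t ht)
  have h1 : ContDiffAt ℝ 1 (fderiv ℝ G) (t, X.x t, X.v t) :=
    (hGs t ht).fderiv_right (by norm_num; exact ENat.LEInfty.out)
  exact DifferentiableAt.comp_differentiableWithinAt (f := fun t => (t, X.x t, X.v t))
    (g := fderiv ℝ G) t (h1.differentiableAt one_ne_zero) (hs t ht).differentiableWithinAt

theorem IsClosedLoop.differentiableWithinAt_Ωd (hX : IsClosedLoop p tol I d τ X)
    (hF : ContDiff ℝ ∞ (fun z : ℝ × E3 × E3 => p.fhat z.1 z.2.1 z.2.2))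
    (h0 : ∀ t ∈ I, p.fhat t (X.x t) (X.v t) ≠ 0) (hI : UniqueDiffOn ℝ I)
    {t : ℝ} (ht : t ∈ I) (hpsi : X.psi p t < 2) :
    DifferentiableWithinAt ℝ (X.Ωd p I) I t := by
  obtain ⟨h1, h2⟩ := hX.differentiable_qd hF h0 hI
  have hR := fun j => (hX.hasDerivWithinAt_bodyAxis ht j).differentiableWithinAt
  refine differentiableWithinAt_horizontal hR ?_
  exact (differentiableWithinAt_cross (differentiableWithinAt_cross (h1 t ht) (h2 t ht))
    (hR 2)).sub ((differentiableWithinAt_attErr (hR 2) (h1 t ht)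
      (Psi_lt_two_iff.1 hpsi)).const_smul p.kq)

/-- The closed-loop equation of the angular velocity error. -/
theorem IsClosedLoop.hasDerivWithinAt_eΩ (hX : IsClosedLoop p tol I d τ X)
    (hF : ContDiff ℝ ∞ (fun z : ℝ × E3 × E3 => p.fhat z.1 z.2.1 z.2.2))
    (h0 : ∀ t ∈ I, p.fhat t (X.x t) (X.v t) ≠ 0) (hI : UniqueDiffOn ℝ I)
    {t : ℝ} (ht : t ∈ I) (hpsi : X.psi p t < 2) :
    HasDerivWithinAt (X.eΩ p I)
      (-(p.α • horizontal (X.R t) (X.eq p t)) - p.kΩ • X.eΩ p I t + d t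
        - X.uncertainty p t • unitSat tol (X.eΩ p I t)) I t := by
  refine ((hX.ang t ht).sub
    (hX.differentiableWithinAt_Ωd hF h0 hI ht hpsi).hasDerivWithinAt).congr_deriv ?_
  rw [Motion.U]
  abel

theorem IsClosedLoop.continuousOn_psi (hX : IsClosedLoop p tol I d τ X)
    (hF : ContDiff ℝ ∞ (fun z : ℝ × E3 × E3 => p.fhat z.1 z.2.1 z.2.2))
    (h0 : ∀ t ∈ I, p.fhat t (X.x t) (X.v t) ≠ 0) (hI : UniqueDiffOn ℝ I) :
    ContinuousOn (X.psi p) I := by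
  have h1 := (hX.differentiable_qd hF h0 hI).1.continuousOn
  have h2 : ContinuousOn X.q I := fun t ht => (hX.hasDerivWithinAt_q ht).continuousWithinAt
  exact continuousOn_const.sub (continuousOn_const.mul
    (continuousOn_const.add (h1.inner h2)).sqrt)

/-- The attitude error function decreases up to the angular velocity error. -/
theorem IsClosedLoop.hasDerivWithinAt_psi (hX : IsClosedLoop p tol I d τ X)
    (hF : ContDiff ℝ ∞ (fun z : ℝ × E3 × E3 => p.fhat z.1 z.2.1 z.2.2))
    (h0 : ∀ t ∈ I, p.fhat t (X.x t) (X.v t) ≠ 0) (hI : UniqueDiffOn ℝ I)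
    {t : ℝ} (ht : t ∈ I) (hpsi : X.psi p t < 2) :
    HasDerivWithinAt (X.psi p)
      (⟪horizontal (X.R t) (X.eq p t), X.eΩ p I t⟫ - p.kq * ‖X.eq p t‖ ^ 2) I t := by
  have hpos : 0 < 1 + ⟪X.qd p t, X.q t⟫ := Psi_lt_two_iff.1 hpsi
  have hqn : ‖X.q t‖ = 1 := norm_bodyAxis _ _
  have hdn : ‖X.qd p t‖ = 1 := Params.norm_qd (h0 t ht)
  have hq := hX.hasDerivWithinAt_q ht
  have hqd := ((hX.differentiable_qd hF h0 hI).1 t ht).hasDerivWithinAt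
  set v := X.Ω t 1 • bodyAxis (X.R t) 0 - X.Ω t 0 • bodyAxis (X.R t) 1 with hv
  set w := derivWithin (X.qd p) I t with hw
  have hqv : ⟪X.q t, v⟫ = 0 := by
    simp [hv, Motion.q, inner_sub_right, inner_smul_right, inner_bodyAxis]
  have hqw : ⟪X.qd p t, w⟫ = 0 := by
    have h1 : HasDerivWithinAt (fun s => ⟪X.qd p s, X.qd p s⟫) 0 I t := by
      refine (hasDerivWithinAt_const t I (1 : ℝ)).congr (fun s hs => ?_) ?_
      · rw [real_inner_self_eq_norm_sq]
        simp [Motion.qd, Params.norm_qd (h0 s hs)]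
      · rw [real_inner_self_eq_norm_sq, hdn]
        simp
    have h2 := (hI t ht).eq_deriv I (hqd.inner ℝ hqd) h1
    rw [real_inner_comm (X.qd p t) w] at h2
    linarith
  have hder : HasDerivWithinAt (X.psi p)
      (-(1 / (√2 * √(1 + ⟪X.qd p t, X.q t⟫)) * (⟪X.qd p t, v⟫ + ⟪w, X.q t⟫))) I t := by
    have h1 := ((((hqd.inner ℝ hq).const_add 1).sqrt hpos.ne').const_mul (2 / √2)).const_sub 2
    refine h1.congr_deriv ?_
    have : 0 < √(1 + ⟪X.qd p t, X.q t⟫) := Real.sqrt_pos.2 hpos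
    field_simp
  refine hder.congr_deriv ?_
  rw [← inner_attErr_sub_transport hqn hdn hqv hqw]
  have h3 := inner_horizontal (X.R t) (X.eq p t) (v - transport (X.q t) (X.qd p t) w)
  have h4 : ⟪bodyAxis (X.R t) 2, X.eq p t⟫ = 0 := inner_attErr_left (norm_bodyAxis _ _)
  rw [h4, zero_mul, sub_zero] at h3
  have h5 : X.eΩ p I t = horizontal (X.R t) (v - transport (X.q t) (X.qd p t) w)
      + p.kq • horizontal (X.R t) (X.eq p t) := by
    rw [Motion.eΩ, Motion.Ωd, ← horizontal_velocity (X.R t) (X.Ω t), ← hv, ← hw,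
      horizontal_sub _ _ (p.kq • X.eq p t), horizontal_sub _ v, horizontal_smul]
    abel
  have h6 : ‖horizontal (X.R t) (X.eq p t)‖ = ‖X.eq p t‖ := norm_horizontal_attErr _
  rw [h5, inner_add_right, inner_smul_right, real_inner_self_eq_norm_sq, h6, h3]
  simp [Motion.eq]

end Motion

/-! ### Convergence of the reduced attitude -/

section TimeInterval

variable {T : EReal} {t b : ℝ}

theorem Icc_subset_timeInterval (hb : b ∈ timeInterval T) : Icc 0 b ⊆ timeInterval T :=
  fun _ hs => ⟨hs.1, (EReal.coe_le_coe_iff.2 hs.2).trans_lt hb.2⟩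

theorem timeInterval_mem_nhdsGE (ht : t ∈ timeInterval T) : timeInterval T ∈ 𝓝[≥] t := by
  have h1 : {s : ℝ | (s : EReal) < T} ∈ 𝓝 t :=
    (isOpen_Iio.preimage continuous_coe_real_ereal).mem_nhds ht.2
  filter_upwards [self_mem_nhdsWithin, mem_nhdsWithin_of_mem_nhds h1] with s hs1 hs2
  exact ⟨ht.1.trans hs1, hs2⟩

theorem uniqueDiffOn_timeInterval : UniqueDiffOn ℝ (timeInterval T) := fun t ht =>
  (uniqueDiffOn_Ici t t self_mem_Ici).mono_nhds
    (nhdsWithin_le_iff.2 (timeInterval_mem_nhdsGE ht))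

theorem hasDerivWithinAt_Ici_of_timeInterval {F : Type*} [NormedAddCommGroup F]
    [NormedSpace ℝ F] {f : ℝ → F} {f' : F} (h : HasDerivWithinAt f f' (timeInterval T) t)
    (ht : t ∈ timeInterval T) : HasDerivWithinAt f f' (Ici t) t :=
  h.mono_of_mem_nhdsWithin (timeInterval_mem_nhdsGE ht)

end TimeInterval

/-- The robust term dominates every admissible uncertainty outside the tolerance ball. -/
theorem inner_sub_smul_unitSat_nonpos {tol u : ℝ} {e d : E2} (htol : 0 < tol) (he : tol ≤ ‖e‖)
    (hd : ‖d‖ ≤ u) : ⟪e, d - u • unitSat tol e⟫ ≤ 0 := by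
  have he0 : 0 < ‖e‖ := htol.trans_le he
  have h1 : ⟪e, unitSat tol e⟫ = ‖e‖ := by
    rw [unitSat]
    split_ifs with h
    · rw [inner_smul_right, real_inner_self_eq_norm_sq]
      field_simp
    · have : tol = ‖e‖ := le_antisymm he (not_lt.1 h)
      rw [inner_smul_right, real_inner_self_eq_norm_sq, this]
      field_simp
  have h2 := real_inner_le_norm e d
  have h3 := mul_le_mul_of_nonneg_left hd he0.le
  rw [inner_sub_right, inner_smul_right, h1]
  linarith

section Attitude

variable {p : Params} {tol : ℝ} {T : EReal} {d : ℝ → E2} {τ : ℝ → ℝ} {X : Motion}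

/-- As long as `Ψ < 2`, the larger of `α Ψ` and `α Ψ + (‖e_Ω‖² - tol²) / 2` satisfies a linear
differential inequality: inside the tolerance ball `Ψ` itself decreases up to a term of size
`tol`, whatever the size of the uncertainty, and outside of it the robust term
dominates the uncertainty. -/
theorem IsClosedLoop.lyapunov_le (hX : IsClosedLoop p tol (timeInterval T) d τ X)
    (hF : ContDiff ℝ ∞ (fun z : ℝ × E3 × E3 => p.fhat z.1 z.2.1 z.2.2))
    (h0 : ∀ t ∈ timeInterval T, p.fhat t (X.x t) (X.v t) ≠ 0)
    (hα : 0 < p.α) {μ D : ℝ} (hμ : 0 < μ) (hμq : μ ≤ p.kq / 2) (hμΩ : μ ≤ 2 * p.kΩ)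
    (htol : 0 < tol) {b : ℝ} (hb : b ∈ timeInterval T) (hpsi : ∀ t ∈ Icc 0 b, X.psi p t < 2)
    (hD : max (p.α * X.psi p 0)
      (p.α * X.psi p 0 + 1 / 2 * (‖X.eΩ p (timeInterval T) 0‖ ^ 2 - tol ^ 2)) ≤ D) :
    ∀ t ∈ Icc 0 b, max (p.α * X.psi p t)
        (p.α * X.psi p t + 1 / 2 * (‖X.eΩ p (timeInterval T) t‖ ^ 2 - tol ^ 2))
      ≤ D * Real.exp (-μ * t) + 2 * (p.α * tol) / μ * (1 - Real.exp (-μ * t)) := by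
  have hI : UniqueDiffOn ℝ (timeInterval T) := uniqueDiffOn_timeInterval
  have hsub := Icc_subset_timeInterval hb
  have hatol : 0 < p.α * tol := mul_pos hα htol
  have dpsi : ∀ t ∈ Icc 0 b, HasDerivWithinAt (fun t => p.α * X.psi p t) _ (timeInterval T) t :=
    fun t ht => (hX.hasDerivWithinAt_psi hF h0 hI (hsub ht) (hpsi t ht)).const_mul p.α
  have dV : ∀ t ∈ Icc 0 b, HasDerivWithinAt
      (fun t => p.α * X.psi p t + 1 / 2 * (‖X.eΩ p (timeInterval T) t‖ ^ 2 - tol ^ 2))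
      _ (timeInterval T) t :=
    fun t ht => (dpsi t ht).add
      (((hX.hasDerivWithinAt_eΩ hF h0 hI (hsub ht) (hpsi t ht)).norm_sq.sub_const
        (tol ^ 2)).const_mul (1 / 2))
  refine max_le_of_deriv_le (δ₀ := p.α * tol) hμ (by linarith)
    (fun t ht => ((dpsi t ht).mono hsub).continuousWithinAt)
    (fun t ht => ((dV t ht).mono hsub).continuousWithinAt)
    (fun t ht => hasDerivWithinAt_Ici_of_timeInterval (dpsi t ⟨ht.1, ht.2.le⟩)
      (hsub ⟨ht.1, ht.2.le⟩))
    (fun t ht => hasDerivWithinAt_Ici_of_timeInterval (dV t ⟨ht.1, ht.2.le⟩)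
      (hsub ⟨ht.1, ht.2.le⟩)) ?_ ?_ hD
  all_goals
    intro t ht hle
    have htI := hsub ⟨ht.1, ht.2.le⟩
    have hpos : 0 < 1 + ⟪X.qd p t, X.q t⟫ := Psi_lt_two_iff.1 (hpsi t ⟨ht.1, ht.2.le⟩)
    have hqn : ‖X.q t‖ = 1 := norm_bodyAxis _ _
    have hdn : ‖X.qd p t‖ = 1 := Params.norm_qd (h0 t htI)
    have hΨ0 : 0 ≤ X.psi p t := Psi_nonneg hqn hdn
    have hΨq : X.psi p t / 2 ≤ ‖X.eq p t‖ ^ 2 := Psi_le_norm_attErr_sq hqn hdn hpos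
    have hq1 : ‖X.eq p t‖ ≤ 1 := norm_attErr_le_one hqn hdn hpos
    have hh : ‖horizontal (X.R t) (X.eq p t)‖ = ‖X.eq p t‖ := norm_horizontal_attErr _
    have hdec : μ * (p.α * X.psi p t) ≤ p.α * (p.kq * ‖X.eq p t‖ ^ 2) := by
      have h1 : μ * X.psi p t ≤ p.kq / 2 * X.psi p t := by gcongr
      have h2 : p.kq * (X.psi p t / 2) ≤ p.kq * ‖X.eq p t‖ ^ 2 :=
        mul_le_mul_of_nonneg_left hΨq (by linarith)
      have h3 := mul_le_mul_of_nonneg_left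
        (h1.trans (by linarith : p.kq / 2 * X.psi p t ≤ p.kq * ‖X.eq p t‖ ^ 2)) hα.le
      linarith
    set e := X.eΩ p (timeInterval T) t with he
    set h := horizontal (X.R t) (X.eq p t) with hhd
  · have hetol : ‖e‖ ≤ tol := abs_le_of_sq_le_sq' (by linarith) htol.le |>.2
    have h1 : ⟪h, e⟫ ≤ tol := by
      have h2 := real_inner_le_norm h e
      have h3 : ‖h‖ * ‖e‖ ≤ 1 * tol := by
        rw [hh]
        gcongr
      linarith
    have := mul_le_mul_of_nonneg_left h1 hα.le
    linarith
  · have hetol : tol ≤ ‖e‖ := abs_le_of_sq_le_sq' (by linarith) (norm_nonneg _) |>.2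
    have h1 := inner_sub_smul_unitSat_nonpos htol hetol (hX.unc t htI)
    have h2 : ⟪e, -(p.α • h) - p.kΩ • e + d t - X.uncertainty p t • unitSat tol e⟫
        = -(p.α * ⟪h, e⟫) - p.kΩ * ‖e‖ ^ 2
          + ⟪e, d t - X.uncertainty p t • unitSat tol e⟫ := by
      rw [add_sub_assoc, inner_add_right, inner_sub_right, inner_neg_right, inner_smul_right,
        inner_smul_right, real_inner_self_eq_norm_sq, real_inner_comm]
    rw [h2]
    have h3 : μ * ‖e‖ ^ 2 ≤ 2 * p.kΩ * ‖e‖ ^ 2 := by gcongr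
    have h4 : 0 ≤ μ * tol ^ 2 := by positivity
    linarith

/-- The attitude error stays below the value `2`, and both attitude errors decay exponentially to
a ball whose size depends on the tolerance only. -/
theorem IsClosedLoop.attitude_bounds (hX : IsClosedLoop p tol (timeInterval T) d τ X)
    (hF : ContDiff ℝ ∞ (fun z : ℝ × E3 × E3 => p.fhat z.1 z.2.1 z.2.2))
    (h0 : ∀ t ∈ timeInterval T, p.fhat t (X.x t) (X.v t) ≠ 0)
    (hα : 0 < p.α) {μ : ℝ} (hμ : 0 < μ) (hμq : μ ≤ p.kq / 2) (hμΩ : μ ≤ 2 * p.kΩ)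
    (htol : 0 < tol) (htolμ : tol < μ) (hpsi0 : X.psi p 0 < 2)
    (hroa : ‖X.eΩ p (timeInterval T) 0‖ ^ 2 < 2 * p.α * (2 - X.psi p 0)) :
    ∀ t ∈ timeInterval T, X.psi p t < 2 ∧
      ‖X.eq p t‖ ^ 2 ≤ 2 * Real.exp (-μ * t) + 2 * tol / μ ∧
      ‖X.eΩ p (timeInterval T) t‖ ^ 2
        ≤ 4 * p.α * Real.exp (-μ * t) + 4 * p.α * tol / μ + tol ^ 2 := by
  set D := max (p.α * X.psi p 0)
    (p.α * X.psi p 0 + 1 / 2 * (‖X.eΩ p (timeInterval T) 0‖ ^ 2 - tol ^ 2)) with hDd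
  have hD : D < 2 * p.α := by
    refine max_lt (by nlinarith) ?_
    have : 0 < tol ^ 2 := by positivity
    linarith
  have hδ : 2 * (p.α * tol) / μ < 2 * p.α := by
    rw [div_lt_iff₀ hμ]
    nlinarith
  have hδ0 : 0 ≤ 2 * (p.α * tol) / μ := by positivity
  have hexp : ∀ t, 0 ≤ t → Real.exp (-μ * t) ≤ 1 := fun t ht =>
    Real.exp_le_one_iff.2 (by nlinarith)
  have hcont := hX.continuousOn_psi hF h0 uniqueDiffOn_timeInterval
  -- At the first time when `Ψ = 2`, the Lyapunov estimate would still give `Ψ < 2`.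
  have hlt : ∀ b ∈ timeInterval T, X.psi p b < 2 := by
    by_contra! hcon
    obtain ⟨b, hb, hb2⟩ := hcon
    have hsub := Icc_subset_timeInterval hb
    have hclosed : IsCompact (Icc 0 b ∩ X.psi p ⁻¹' Ici 2) :=
      isCompact_Icc.of_isClosed_subset
        ((hcont.mono hsub).preimage_isClosed_of_isClosed isClosed_Icc isClosed_Ici)
        inter_subset_left
    obtain ⟨s, hs, hmin⟩ := hclosed.exists_isLeast ⟨b, ⟨hb.1, le_rfl⟩, hb2⟩
    have hs0 : 0 < s := by
      rcases hs.1.1.eq_or_lt with h | h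
      · have : 2 ≤ X.psi p s := hs.2
        rw [← h] at this
        linarith
      · exact h
    have hbefore : ∀ t ∈ Ico 0 s, X.psi p t ≤ max D (2 * (p.α * tol) / μ) / p.α := by
      intro t ht
      have htb : t ≤ b := ht.2.le.trans hs.1.2
      have h1 := hX.lyapunov_le hF h0 hα hμ hμq hμΩ htol (hsub ⟨ht.1, htb⟩)
        (fun u hu => by
          by_contra! h
          have := hmin ⟨⟨hu.1, hu.2.trans htb⟩, h⟩
          linarith [hu.2, ht.2]) hDd.ge t (right_mem_Icc.2 ht.1)
      have h2 := (le_max_left _ _).trans h1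
      have h3 := mul_le_mul_of_nonneg_right (le_max_left D (2 * (p.α * tol) / μ))
        (Real.exp_pos (-μ * t)).le
      have h4 := mul_le_mul_of_nonneg_right (le_max_right D (2 * (p.α * tol) / μ))
        (sub_nonneg.2 (hexp t ht.1))
      rw [le_div_iff₀ hα]
      linarith
    have hne : (𝓝[Ico 0 s] s).NeBot := mem_closure_iff_nhdsWithin_neBot.1 (by
      rw [closure_Ico hs0.ne]
      exact right_mem_Icc.2 hs0.le)
    have h1 : X.psi p s ≤ max D (2 * (p.α * tol) / μ) / p.α :=
      le_of_tendsto ((hcont s (hsub hs.1)).mono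
        (fun t ht => hsub ⟨ht.1, ht.2.le.trans hs.1.2⟩)) (eventually_mem_nhdsWithin.mono hbefore)
    have h2 : 2 ≤ X.psi p s := hs.2
    rw [le_div_iff₀ hα] at h1
    have h3 := max_lt hD hδ
    nlinarith
  intro t ht
  have hpos : 0 < 1 + ⟪X.qd p t, X.q t⟫ := Psi_lt_two_iff.1 (hlt t ht)
  have hqn : ‖X.q t‖ = 1 := norm_bodyAxis _ _
  have hdn : ‖X.qd p t‖ = 1 := Params.norm_qd (h0 t ht)
  have hΨ0 : 0 ≤ X.psi p t := Psi_nonneg hqn hdn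
  have hqΨ : ‖X.eq p t‖ ^ 2 ≤ X.psi p t := norm_attErr_sq_le_Psi hqn hdn hpos
  have hV := hX.lyapunov_le hF h0 hα hμ hμq hμΩ htol ht
    (fun u hu => hlt u (Icc_subset_timeInterval ht hu)) hDd.ge t (right_mem_Icc.2 ht.1)
  have hE := Real.exp_pos (-μ * t)
  have h3 : D * Real.exp (-μ * t) + 2 * (p.α * tol) / μ * (1 - Real.exp (-μ * t))
      ≤ p.α * (2 * Real.exp (-μ * t) + 2 * tol / μ) := by
    have h4 := mul_le_mul_of_nonneg_right hD.le hE.le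
    have h5 := mul_nonneg hδ0 hE.le
    have h6 : p.α * (2 * tol / μ) = 2 * (p.α * tol) / μ := by ring
    linarith
  refine ⟨hlt t ht, ?_, ?_⟩
  · exact hqΨ.trans (le_of_mul_le_mul_left (((le_max_left _ _).trans hV).trans h3) hα)
  · have h4 := ((le_max_right _ _).trans hV).trans h3
    have h5 : 0 ≤ p.α * X.psi p t := by positivity
    have h6 : 4 * p.α * tol / μ = 2 * (p.α * (2 * tol / μ)) := by ring
    rw [h6]
    linarith

end Attitude

/-! ### The set of good initial states -/

/-- The rotation by the angle `θ` about the first axis. -/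
noncomputable def rotX (θ : ℝ) : SO3 :=
  ⟨!![1, 0, 0; 0, Real.cos θ, -Real.sin θ; 0, Real.sin θ, Real.cos θ], by
    have h := Real.sin_sq_add_cos_sq θ
    rw [Matrix.mem_specialOrthogonalGroup_iff, Matrix.mem_orthogonalGroup_iff]
    constructor
    · ext i j
      fin_cases i <;> fin_cases j <;>
        simp [Matrix.mul_apply, Fin.sum_univ_three] <;> nlinarith
    · simp [Matrix.det_fin_three]
      nlinarith⟩

theorem rotX_zero : rotX 0 = 1 := by
  ext i j
  fin_cases i <;> fin_cases j <;> simp [rotX]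

theorem continuous_rotX : Continuous rotX := by
  refine Continuous.subtype_mk (continuous_matrix fun i j => ?_) _
  fin_cases i <;> fin_cases j <;> simp <;> fun_prop

theorem bodyAxis_mul_rotX (R : SO3) (θ : ℝ) :
    bodyAxis (R * rotX θ) 2 = Real.cos θ • bodyAxis R 2 - Real.sin θ • bodyAxis R 1 := by
  ext k
  simp [bodyAxis, rotX, Matrix.mul_apply, Fin.sum_univ_three]
  ring

theorem continuous_bodyAxis (j : Fin 3) : Continuous (fun R : SO3 => bodyAxis R j) := by
  refine (PiLp.continuous_toLp 2 _).comp (continuous_pi fun k => ?_)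
  exact (continuous_apply_apply k j).comp continuous_subtype_val

section GoodStates

variable {p : Params}

theorem Params.isOpen_goodStates
    (hF : ContDiff ℝ ∞ (fun z : ℝ × E3 × E3 => p.fhat z.1 z.2.1 z.2.2))
    (h0 : ∀ x v, p.fhat 0 x v ≠ 0) : IsOpen p.goodStates := by
  have hqd : Continuous (fun z : E3 × E3 × SO3 × E3 => p.qd 0 z.1 z.2.1) := by
    refine continuous_iff_continuousAt.2 fun z => ?_
    have h1 := (Params.contDiffAt_qd hF (z := (0, z.1, z.2.1)) (h0 _ _)).continuousAt
    exact ContinuousAt.comp (g := fun z : ℝ × E3 × E3 => p.qd z.1 z.2.1 z.2.2)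
      (f := fun z : E3 × E3 × SO3 × E3 => ((0 : ℝ), z.1, z.2.1)) h1 (by fun_prop)
  have hq : Continuous (fun z : E3 × E3 × SO3 × E3 => bodyAxis z.2.2.1 2) :=
    (continuous_bodyAxis 2).comp (by fun_prop)
  simp only [Params.goodStates, Psi_lt_two_iff]
  exact isOpen_lt continuous_const (continuous_const.add (hqd.inner hq))

/-- If the thrust axis is opposite to the commanded one, any small rotation about a horizontal
body axis leads into the set of good states. -/
theorem Params.dense_goodStates (h0 : ∀ x v, p.fhat 0 x v ≠ 0) : Dense p.goodStates := by
  rintro ⟨x, v, R, Ω⟩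
  by_cases hz : (x, v, R, Ω) ∈ p.goodStates
  · exact subset_closure hz
  have hdn : ‖p.qd 0 x v‖ = 1 := Params.norm_qd (h0 x v)
  have hqn := norm_bodyAxis R 2
  have hle : ⟪p.qd 0 x v, bodyAxis R 2⟫ = -1 := by
    have h1 : ¬ 0 < 1 + ⟪p.qd 0 x v, bodyAxis R 2⟫ := fun h => hz (Psi_lt_two_iff.2 h)
    have h2 := (inner_mem_Icc hqn hdn).1
    linarith
  have hqd : p.qd 0 x v = -bodyAxis R 2 := by
    have h1 := norm_add_sq_real (p.qd 0 x v) (bodyAxis R 2)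
    rw [hle, hdn, hqn] at h1
    have h2 : ‖p.qd 0 x v + bodyAxis R 2‖ = 0 := pow_eq_zero_iff two_ne_zero |>.1 (by linarith)
    exact eq_neg_of_add_eq_zero_left (norm_eq_zero.1 h2)
  have htend : Tendsto (fun θ => (x, v, R * rotX θ, Ω)) (𝓝[>] 0) (𝓝 (x, v, R, Ω)) := by
    have h1 : Continuous (fun θ => (x, v, R * rotX θ, Ω)) := by
      have := continuous_rotX
      fun_prop
    have h2 := h1.tendsto 0
    rw [rotX_zero, mul_one] at h2
    exact h2.mono_left nhdsWithin_le_nhds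
  refine mem_closure_of_tendsto htend ?_
  filter_upwards [Ioo_mem_nhdsGT Real.pi_pos] with θ hθ
  refine Psi_lt_two_iff.2 ?_
  have hcos : Real.cos θ < 1 := by
    rw [← Real.cos_zero]
    exact Real.strictAntiOn_cos ⟨le_rfl, Real.pi_pos.le⟩ ⟨hθ.1.le, hθ.2.le⟩ hθ.1
  rw [bodyAxis_mul_rotX, hqd, inner_neg_left, inner_sub_right, inner_smul_right,
    inner_smul_right, inner_bodyAxis, inner_bodyAxis]
  simpa using hcos

end GoodStates

/-! ### Convergence of the position error -/

theorem norm_le_sum_abs (x : E3) : ‖x‖ ≤ ∑ i, |x i| := by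
  rw [EuclideanSpace.norm_eq, Real.sqrt_le_left (by positivity)]
  simp only [Real.norm_eq_abs, Fin.sum_univ_three]
  have h1 : 0 ≤ |x 0| * |x 1| := by positivity
  have h2 : 0 ≤ |x 0| * |x 2| := by positivity
  have h3 : 0 ≤ |x 1| * |x 2| := by positivity
  nlinarith

theorem abs_apply_le_norm (x : E3) (i : Fin 3) : |x i| ≤ ‖x‖ := PiLp.norm_apply_le x i

theorem le_of_sq_le_mul_sq_add {x A B E : ℝ} (hA : 0 ≤ A) (hB : 0 ≤ B) (hE : 0 ≤ E)
    (h : x ^ 2 ≤ A * E ^ 2 + B) : x ≤ √A * E + √B := by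
  refine abs_le_of_sq_le_sq' ?_ (by positivity) |>.2
  have h1 : 0 ≤ √A * E * √B := by positivity
  have h2 : (√A * E + √B) ^ 2 = √A ^ 2 * E ^ 2 + 2 * (√A * E * √B) + √B ^ 2 := by ring
  rw [h2, Real.sq_sqrt hA, Real.sq_sqrt hB]
  linarith

theorem Params.norm_thrust_le {p : Params} {a₂ b₂ F t : ℝ} (hσ₂ : IsSaturation a₂ b₂ p.σ₂)
    (hF : ‖p.fd t‖ ≤ F) (ex ev : E3) : ‖p.thrust t ex ev‖ ≤ 3 * b₂ + F := by
  refine (norm_add_le _ _).trans (add_le_add ((norm_le_sum_abs _).trans ?_) hF)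
  have h : ∀ i, |p.sigmaBar ex ev i| ≤ b₂ := fun i => by
    simpa [Params.sigmaBar] using hσ₂.bounded _
  rw [Fin.sum_univ_three]
  linarith [h 0, h 1, h 2]

/-- The translational closed loop: every component of the position error is a double integrator
with nested saturations, driven by the thrust error `⟨f̂, q⟩ q - f̂`. -/
theorem IsClosedLoop.hasDerivWithinAt_ev {p : Params} {tol : ℝ} {I : Set ℝ} {d : ℝ → E2}
    {τ : ℝ → ℝ} {X : Motion} (hX : IsClosedLoop p tol I d τ X) (hm : 0 < p.m)
    (hxd : ContDiff ℝ ∞ p.xd) {t : ℝ} (ht : t ∈ I) (i : Fin 3) :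
    HasDerivWithinAt (fun t => X.ev p t i)
      (p.m⁻¹ * (-p.σ₂ (p.k₁ / p.k₂ * X.ev p t i
          + p.σ₁ (p.k₂ * p.m * X.ev p t i + p.k₁ * X.ex p t i))
        + (⟪p.fhat t (X.x t) (X.v t), X.q t⟫ • X.q t - p.fhat t (X.x t) (X.v t)) i)) I t := by
  have h1 : HasDerivAt (deriv p.xd) (iteratedDeriv 2 p.xd t) t := by
    have h2 : Differentiable ℝ (deriv p.xd) :=
      (hxd.iterate_deriv 1).differentiable (by simp)
    rw [iteratedDeriv_eq_iterate]
    exact (h2 t).hasDerivAt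
  have h2 := (EuclideanSpace.proj (𝕜 := ℝ) i).hasFDerivAt.comp_hasDerivWithinAt t
    ((hX.vel t ht).sub h1.hasDerivWithinAt)
  refine h2.congr_deriv ?_
  have h3 : p.fhat t (X.x t) (X.v t) i
      = -p.σ₂ (p.k₁ / p.k₂ * X.ev p t i
          + p.σ₁ (p.k₂ * p.m * X.ev p t i + p.k₁ * X.ex p t i))
        + (p.m * iteratedDeriv 2 p.xd t i + p.m * p.g * e3 i) := by
    simp [Params.fhat, Params.thrust, Params.sigmaBar, Params.fd, Motion.ev, Motion.ex]
  rw [PiLp.sub_apply, h3]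
  simp [Params.netThrust, Motion.q]
  field_simp
  ring

theorem IsClosedLoop.hasDerivWithinAt_ex {p : Params} {tol : ℝ} {I : Set ℝ} {d : ℝ → E2}
    {τ : ℝ → ℝ} {X : Motion} (hX : IsClosedLoop p tol I d τ X)
    (hxd : ContDiff ℝ ∞ p.xd) {t : ℝ} (ht : t ∈ I) (i : Fin 3) :
    HasDerivWithinAt (fun t => X.ex p t i) (X.ev p t i) I t :=
  (EuclideanSpace.proj (𝕜 := ℝ) i).hasFDerivAt.comp_hasDerivWithinAt t
    ((hX.pos t ht).sub ((hxd.differentiable (by simp)) t).hasDerivAt.hasDerivWithinAt)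

/-- The convergence theorem, for given lower bounds `ς₁, ς₂` of the saturations on bounded ranges.
The tolerance depends on the size `r` of the initial errors only through these bounds. -/
theorem exists_convergesFrom {p : Params} {a₁ b₁ a₂ b₂ F μ lam : ℝ} {ς₁ ς₂ : ℝ → ℝ}
    (hm : 0 < p.m) (hk₁ : 0 < p.k₁) (hk₂ : 0 < p.k₂) (hα : 0 < p.α)
    (hσ₁ : IsSaturation a₁ b₁ p.σ₁) (hσ₂ : IsSaturation a₂ b₂ p.σ₂) (hab : b₁ < a₂ / 2)
    (hxd : ContDiff ℝ ∞ p.xd) (hfd : ∀ t, 0 ≤ t → ‖p.fd t‖ ≤ F)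
    (hthrust : ∀ t, 0 ≤ t → ∀ x v, p.fhat t x v ≠ 0)
    (hς₁ : ∀ S, 0 < ς₁ S) (hς₂ : ∀ S, 0 < ς₂ S)
    (hς₁' : ∀ S s, a₁ ≤ |s| → |s| ≤ S → ς₁ S ≤ |p.σ₁ s|)
    (hς₂' : ∀ S s, a₂ / 2 - b₁ ≤ |s| → |s| ≤ S → ς₂ S ≤ |p.σ₂ s|)
    (hμ : 0 < μ) (hμq : μ ≤ p.kq / 2) (hμΩ : μ ≤ 2 * p.kΩ)
    (hlam : 0 < lam) (hlamμ : 2 * lam ≤ μ) (hlam₁ : lam < p.k₂)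
    (hlam₂ : lam < p.k₁ / p.k₂ / p.m) :
    ∃ C S₁ S₂ : ℝ → ℝ, ∀ ς > 0, ∀ ε > 0, ∃ tol₀ > 0, ∀ tol, 0 < tol → tol ≤ tol₀ →
      ∀ r : ℝ, ς ≤ ς₁ (S₁ r) → ς ≤ ς₂ (S₂ r) → ConvergesFrom p tol r (C r) lam ε := by
  have hF := Params.contDiff_fhat hσ₁.smooth hσ₂.smooth hxd
  have hb₂ : 0 < b₂ := hσ₂.a_pos.trans_le hσ₂.a_le_b
  have hF0 : 0 ≤ F := (norm_nonneg _).trans (hfd 0 le_rfl)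
  set M := 3 * b₂ + F with hMd
  have hM : 0 ≤ M := by positivity
  obtain ⟨K, hK, hKr⟩ := nested_saturation_bound (W := 2 * M * √2) hm hk₁ hk₂ hσ₁ hσ₂ hab
    hς₁ hς₂ hς₁' hς₂' hlam hlam₁ hlam₂ (by positivity)
  choose C S₁ S₂ hbound using hKr
  refine ⟨fun r => 3 * C r + √2 + √(4 * p.α), S₁, S₂, fun ς hς ε hε => ?_⟩
  -- `η tol` bounds the persistent part of the thrust error, `ρ tol` that of the total error.
  set η : ℝ → ℝ := fun tol => 2 * M * √(2 * tol / μ) with hηd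
  set ρ : ℝ → ℝ := fun tol => 3 * (K * η tol) + √(2 * tol / μ)
    + √(4 * p.α * tol / μ + tol ^ 2) with hρd
  have hsmall : ∀ᶠ tol in 𝓝[>] (0 : ℝ), tol < μ ∧ η tol < ς / 2 ∧ ρ tol < ε := by
    refine nhdsWithin_le_nhds ?_
    have h1 : Continuous η := by fun_prop
    have h2 : Continuous ρ := by fun_prop
    refine (eventually_lt_nhds hμ).and
      ((h1.continuousAt.eventually (eventually_lt_nhds ?_)).and
        (h2.continuousAt.eventually (eventually_lt_nhds ?_)))
    · simpa [hηd] using hς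
    · simpa [hρd, hηd] using hε
  obtain ⟨tol₀, htol₀, hsub⟩ := mem_nhdsGT_iff_exists_Ioc_subset.1 hsmall
  refine ⟨tol₀, htol₀, fun tol htol htolle r hr₁ hr₂ => ?_⟩
  obtain ⟨htolμ, hη, hρ⟩ := hsub ⟨htol, htolle⟩
  intro T d τ X hT hX hr hgood hroa t ht
  have h0 : ∀ t ∈ timeInterval T, p.fhat t (X.x t) (X.v t) ≠ 0 := fun t ht =>
    hthrust t ht.1 _ _
  have hatt := hX.attitude_bounds hF h0 hα hμ hμq hμΩ htol htolμ hgood hroa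
  have hexp : ∀ s, 0 ≤ s → Real.exp (-μ * s) ≤ Real.exp (-lam * s) ^ 2 := by
    intro s hs
    rw [← Real.exp_nat_mul, Real.exp_le_exp]
    push_cast
    nlinarith
  have heq : ∀ s ∈ timeInterval T, ‖X.eq p s‖ ≤ √2 * Real.exp (-lam * s) + √(2 * tol / μ) := by
    intro s hs
    refine le_of_sq_le_mul_sq_add zero_le_two (by positivity) (Real.exp_pos _).le ?_
    linarith [(hatt s hs).2.1, hexp s hs.1]
  have heΩ : ‖X.eΩ p (timeInterval T) t‖
      ≤ √(4 * p.α) * Real.exp (-lam * t) + √(4 * p.α * tol / μ + tol ^ 2) := by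
    refine le_of_sq_le_mul_sq_add (by positivity) (by positivity) (Real.exp_pos _).le ?_
    have := mul_le_mul_of_nonneg_left (hexp t ht.1) (by positivity : 0 ≤ 4 * p.α)
    linarith [(hatt t ht).2.2]
  have hthr : ∀ s ∈ timeInterval T,
      ‖⟪p.fhat s (X.x s) (X.v s), X.q s⟫ • X.q s - p.fhat s (X.x s) (X.v s)‖
        ≤ 2 * M * √2 * Real.exp (-lam * s) + η tol := by
    intro s hs
    have hf : p.fhat s (X.x s) (X.v s) = ‖p.fhat s (X.x s) (X.v s)‖ • X.qd p s := by
      rw [Motion.qd, Params.qd, smul_smul, mul_inv_cancel₀ (norm_ne_zero_iff.2 (h0 s hs)),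
        one_smul]
    have h1 : ⟪p.fhat s (X.x s) (X.v s), X.q s⟫ • X.q s - p.fhat s (X.x s) (X.v s)
        = ‖p.fhat s (X.x s) (X.v s)‖ • (⟪X.qd p s, X.q s⟫ • X.q s - X.qd p s) := by
      nth_rewrite 1 2 [hf]
      rw [inner_smul_left, smul_sub, smul_smul]
      simp
    have h2 : ‖p.fhat s (X.x s) (X.v s)‖ ≤ M := Params.norm_thrust_le hσ₂ (hfd s hs.1) _ _
    have h3 : ‖⟪X.qd p s, X.q s⟫ • X.q s - X.qd p s‖ ≤ 2 * ‖X.eq p s‖ :=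
      norm_projection_le (norm_bodyAxis _ _) (Params.norm_qd (h0 s hs))
        (Psi_lt_two_iff.1 (hatt s hs).1)
    rw [h1, norm_smul, norm_norm]
    calc ‖p.fhat s (X.x s) (X.v s)‖ * ‖⟪X.qd p s, X.q s⟫ • X.q s - X.qd p s‖
        ≤ M * (2 * (√2 * Real.exp (-lam * s) + √(2 * tol / μ))) := by
          gcongr
          exact h3.trans (by linarith [heq s hs])
      _ = _ := by rw [hηd]; ring
  have hinit : ‖X.ex p 0‖ ≤ r ∧ ‖X.ev p 0‖ ≤ r := by
    rw [Motion.totalError] at hr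
    have h1 := norm_nonneg (X.ex p 0)
    have h2 := norm_nonneg (X.ev p 0)
    have h3 := norm_nonneg (X.eq p 0)
    have h4 := norm_nonneg (X.eΩ p (timeInterval T) 0)
    exact ⟨by linarith, by linarith⟩
  have hsubI := Icc_subset_timeInterval ht
  have hcomp : ∀ i, |X.ex p t i| + |X.ev p t i|
      ≤ C r * Real.exp (-lam * t) + K * η tol := by
    intro i
    refine hbound r t (η tol) (fun t => X.ex p t i) (fun t => X.ev p t i) _ (by positivity)
      (by linarith) (by linarith)
      (fun s hs => (hX.hasDerivWithinAt_ex hxd (hsubI hs) i).continuousWithinAt.mono hsubI)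
      (fun s hs => (hX.hasDerivWithinAt_ev hm hxd (hsubI hs) i).continuousWithinAt.mono hsubI)
      (fun s hs => hasDerivWithinAt_Ici_of_timeInterval
        (hX.hasDerivWithinAt_ex hxd (hsubI ⟨hs.1, hs.2.le⟩) i) (hsubI ⟨hs.1, hs.2.le⟩))
      (fun s hs => hasDerivWithinAt_Ici_of_timeInterval
        (hX.hasDerivWithinAt_ev hm hxd (hsubI ⟨hs.1, hs.2.le⟩) i) (hsubI ⟨hs.1, hs.2.le⟩))
      (fun s hs => (abs_apply_le_norm _ i).trans (hthr s (hsubI ⟨hs.1, hs.2.le⟩)))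
      ((abs_apply_le_norm _ i).trans hinit.1) ((abs_apply_le_norm _ i).trans hinit.2)
      t (right_mem_Icc.2 ht.1)
  refine ⟨(hatt t ht).1, ?_⟩
  have hex := norm_le_sum_abs (X.ex p t)
  have hev := norm_le_sum_abs (X.ev p t)
  rw [Fin.sum_univ_three] at hex hev
  have hρ' : 3 * (K * η tol) + √(2 * tol / μ) + √(4 * p.α * tol / μ + tol ^ 2) < ε := hρ
  rw [Motion.totalError]
  linarith [hcomp 0, hcomp 1, hcomp 2, heq t ht]

end Quadrotor

theorem theorem2 (p : Quadrotor.Params) (a₁ b₁ a₂ b₂ θ₀ c : ℝ)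
    -- plant
    (hm : 0 < p.m) (hJ₁ : 0 < p.J₁) (hJ₂ : 0 < p.J₂) (hJ₃ : 0 < p.J₃)
    -- gains
    (hk₁ : 0 < p.k₁) (hk₂ : 0 < p.k₂) (hkq : 0 < p.kq) (hkΩ : 0 < p.kΩ) (hα : 0 < p.α)
    (hΔ : 0 ≤ p.Δ)
    -- saturation functions
    (hσ₁ : Quadrotor.IsSaturation a₁ b₁ p.σ₁) (hσ₂ : Quadrotor.IsSaturation a₂ b₂ p.σ₂)
    (hab : b₁ < a₂ / 2)
    -- smooth reference trajectory, bounded with all its derivatives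
    (hxd : ContDiff ℝ ((⊤ : ℕ∞) : WithTop ℕ∞) p.xd)
    (hxdb : ∀ n : ℕ, ∃ M : ℝ, ∀ t : ℝ, 0 ≤ t → ‖iteratedDeriv n p.xd t‖ ≤ M)
    -- the commanded thrust vector is bounded away from zero
    (hthrust : ∃ μ > 0, ∀ t : ℝ, 0 ≤ t → ∀ ex ev : Quadrotor.E3, μ ≤ ‖p.thrust t ex ev‖)
    -- the gain conditions, with `k_x = k₁` and `k_v = k₁ / k₂ + m k₂`
    (hθ₀ : 0 ≤ θ₀) (hθ₀' : θ₀ < Real.pi / 2) (hc : 0 < c)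
    (hc₁ : c < p.k₁ * (p.k₁ / p.k₂ + p.m * p.k₂) * (1 - Real.sin θ₀) ^ 2 *
      (p.k₁ * (1 - Real.sin θ₀) +
        (p.k₁ / p.k₂ + p.m * p.k₂) ^ 2 * (1 + Real.sin θ₀) ^ 2 / (4 * p.m))⁻¹)
    (hc₂ : c < (p.k₁ / p.k₂ + p.m * p.k₂) * (1 - Real.sin θ₀))
    (hc₃ : c < √(p.k₁ / p.m))
    (hgain : ∀ t : ℝ, 0 ≤ t →
      4 * Quadrotor.specNorm (Quadrotor.W₂ p.m c a₁ ‖p.fd t‖) ^ 2 /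
        Quadrotor.minEigenvalue
          (Quadrotor.W₁ p.m p.k₁ (p.k₁ / p.k₂ + p.m * p.k₂) c (Real.sin θ₀))
        < min (p.α * p.kq) p.kΩ) :
    -- the initial states form an open dense set
    IsOpen p.goodStates ∧ Dense p.goodStates ∧
    -- exponential convergence, with a rate independent of everything but the data
    ∃ lam > 0,
      -- for initial errors of any given size: to an arbitrarily small neighbourhood
      (∀ r : ℝ, ∃ C : ℝ, ∀ ε > 0, ∃ tol₀ > 0, ∀ tol, 0 < tol → tol ≤ tol₀ →
        Quadrotor.ConvergesFrom p tol r C lam ε) ∧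
      -- with one controller for all initial errors, if the saturations are nondecreasing
      (Monotone p.σ₁ → Monotone p.σ₂ →
        ∃ C : ℝ → ℝ, ∀ ε > 0, ∃ tol₀ > 0, ∀ tol, 0 < tol → tol ≤ tol₀ →
          ∀ r : ℝ, Quadrotor.ConvergesFrom p tol r (C r) lam ε) := by
  obtain ⟨M₂, hM₂⟩ := hxdb 2
  obtain ⟨β, hβ, hthrust⟩ := hthrust
  have h0 : ∀ t : ℝ, 0 ≤ t → ∀ x v, p.fhat t x v ≠ 0 := fun t ht x v h => by
    have h1 : β ≤ ‖p.fhat t x v‖ := hthrust t ht _ _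
    rw [h, norm_zero] at h1
    linarith
  have hfd : ∀ t : ℝ, 0 ≤ t → ‖p.fd t‖ ≤ p.m * M₂ + ‖(p.m * p.g) • Quadrotor.e3‖ := by
    intro t ht
    refine (norm_add_le _ _).trans ?_
    rw [norm_smul, Real.norm_of_nonneg hm.le]
    gcongr
    exact hM₂ t ht
  have hF := Quadrotor.Params.contDiff_fhat hσ₁.smooth hσ₂.smooth hxd
  refine ⟨Quadrotor.Params.isOpen_goodStates hF (h0 0 le_rfl),
    Quadrotor.Params.dense_goodStates (h0 0 le_rfl), ?_⟩
  set μ := min (p.kq / 2) (2 * p.kΩ) with hμd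
  set ν := min μ (min p.k₂ (p.k₁ / p.k₂ / p.m)) with hνd
  have hμ : 0 < μ := lt_min (by positivity) (by positivity)
  have hν : 0 < ν := lt_min hμ (lt_min hk₂ (by positivity))
  have hν₁ : ν ≤ p.k₂ := (min_le_right _ _).trans (min_le_left _ _)
  have hν₂ : ν ≤ p.k₁ / p.k₂ / p.m := (min_le_right _ _).trans (min_le_right _ _)
  have hν₃ : ν ≤ μ := min_le_left _ _
  have hgap : 0 < a₂ / 2 - b₁ := by linarith
  have ha₁ := hσ₁.a_pos
  have hb₁ := hσ₁.a_le_b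
  refine ⟨ν / 2, by positivity, fun r => ?_, fun hmono₁ hmono₂ => ?_⟩
  · choose ς₁ hς₁ hς₁' using hσ₁.exists_lower_bound ha₁
    choose ς₂ hς₂ hς₂' using hσ₂.exists_lower_bound hgap
    obtain ⟨C, S₁, S₂, hC⟩ := Quadrotor.exists_convergesFrom hm hk₁ hk₂ hα hσ₁ hσ₂ hab hxd
      hfd h0 hς₁ hς₂ hς₁' hς₂' hμ (min_le_left _ _) (min_le_right _ _) (half_pos hν) (by linarith)
      (by linarith) (by linarith)
    refine ⟨C r, fun ε hε => ?_⟩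
    obtain ⟨tol₀, htol₀, h⟩ := hC (min (ς₁ (S₁ r)) (ς₂ (S₂ r))) (lt_min (hς₁ _) (hς₂ _)) ε hε
    exact ⟨tol₀, htol₀, fun tol h1 h2 => h tol h1 h2 r (min_le_left _ _) (min_le_right _ _)⟩
  · obtain ⟨C, S₁, S₂, hC⟩ := Quadrotor.exists_convergesFrom (ς₁ := fun _ => a₁)
      (ς₂ := fun _ => a₂ / 2 - b₁) hm hk₁ hk₂ hα hσ₁ hσ₂ hab hxd hfd h0 (fun _ => ha₁)
      (fun _ => hgap)
      (fun _ s hs _ => hσ₁.lower_bound_of_monotone hmono₁ ha₁ le_rfl hs)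
      (fun _ s hs _ => hσ₂.lower_bound_of_monotone hmono₂ hgap (by linarith) hs)
      hμ (min_le_left _ _) (min_le_right _ _) (half_pos hν) (by linarith)
      (by linarith) (by linarith)
    refine ⟨C, fun ε hε => ?_⟩
    obtain ⟨tol₀, htol₀, h⟩ := hC (min a₁ (a₂ / 2 - b₁)) (lt_min ha₁ hgap) ε hε
    exact ⟨tol₀, htol₀, fun tol h1 h2 r => h tol h1 h2 r (min_le_left _ _) (min_le_right _ _)⟩
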